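/- **Setting.** Let $k$ be a field of characteristic $0$, $V$ a finite-dimensional $k$-vector space, and $G\subset \mathrm{GL}(V)$ a finite group generated by reflections (elements $s$ of finite order such that $\ker(s-1)$ is a hyperplane). Let $M$ be a $kG$-module of finite dimension $r$ and $\chi:G\to k^\times$ a linear character. Let $\mathscr H$ be the set of the hyperplanes $\ker(s-1)$, $s\in G$ a reflection. For $H\in\mathscr H$ choose a linear form $\alpha_H\in V^*$ with kernel $H$, let $G_H$ be the pointwise stabilizer of $H$ in $G$, and let $e_H=|G_H|$. For a finite-dimensional $kG$-module $N$, let $n_{j,H}(N)$ be the multiplicity of $\det_V^{-j}$ in $N|_{G_H}$ ($0\le j<e_H$) and $n_H(N)=\sum_j j\,n_{j,H}(N)$; let $n_H(\chi)=n_H(k_\chi)$ and $Q_\chi=\prod_{H\in\mathscr H}\alpha_H^{n_H(\chi)}\in S(V^*)$. Write $M|_{G_H}\simeq \det_V^{-j_1}\oplus\cdots\oplus\det_V^{-j_r}$ with $0\le j_i<e_H$. The hyperplane $H$ is *$M$-good* if $n_H(M)<e_H$, and *$(M,\chi)$-acceptable* if, for every partition $\{1,\dots,r\}=I_1\sqcup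 I_2$, one has $\sum_{i\in I_1}j_i<e_H-n_H(\chi)$ or $\sum_{i\in I_2}j_i<e_H-n_H(\chi)$. Let $\mathscr B\subset\mathscr H$ be a $G$-stable subset such that every $H\in\mathscr H\setminus\mathscr B$ is $M$-good and $(M,\chi)$-acceptable. Let $T\subset S(V^*)$ be the multiplicative set generated by the $\alpha_H$, $H\in\mathscr B$, let $T^G$ be the set of its $G$-invariant elements, $R=S(V^*)^G$, and view $(T^G)^{-1}R$ as a subring of $T^{-1}S(V^*)$. Let $\Omega=T^{-1}S(V^*)\otimes\Lambda(M^*)$ and $\Omega^p=T^{-1}S(V^*)\otimes\Lambda^p(M^*)$, with the natural diagonal action of $G$, and let $\Omega^\chi$, $(\Omega^p)^\chi$ be the sets of their elements $x$ such that $gx=\chi(g)x$ for all $g\in G$. Let $\det_M$ be the determinant of the representation $M$ and $\mathrm{vol}_M$ a nonzero element of $\Lambda^r(M^*)$. **Statement.** For all $\mu,\omega\in\Omega^\chi$ there is a unique $\nu\in\Omega$ with $Q_\chi\,\nu=\mu\wedge\omega$, and $\nu\in\Omega^\chi$; so the twisted product $\mu\curlywedge\omega:=\nu=Q_\chi^{-1}\,\mu\wedge\omega$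 is well defined on $\Omega^\chi$ (the empty twisted product is its unit $Q_\chi$). Moreover, for every $\omega_1,\dots,\omega_r\in(\Omega^1)^\chi$, the following are equivalent: 1. for every $p\in\{1,\dots,r\}$, the family $(\omega_{i_1}\curlywedge\cdots\curlywedge\omega_{i_p})_{1\le i_1<\cdots<i_p\le r}$ is a $(T^G)^{-1}R$-basis of $(\Omega^p)^\chi$; 2. there is a unit $x$ of the ring $(T^G)^{-1}R$ such that $x\,(\omega_1\curlywedge\cdots\curlywedge\omega_r)=Q_{\chi\cdot\det_M}\,\mathrm{vol}_M$. -/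

import Mathlib

open scoped TensorProduct

namespace TwistedExterior

noncomputable section

/-! ### Reflections and hyperplanes -/

section Hyperplanes

variable {k : Type*} [Field k] {V : Type*} [AddCommGroup V] [Module k V]

/-- `s` is a reflection when it has finite order and `ker (s - 1)` is a hyperplane. -/
def IsReflection (s : V ≃ₗ[k] V) : Prop :=
  IsOfFinOrder s ∧ Module.finrank k (LinearMap.ker ((s : V →ₗ[k] V) - LinearMap.id)) + 1 = Module.finrank k V

/-- The set of the hyperplanes `ker (s - 1)` where `s` runs over the reflections of `G`. -/
def hyperplanes (G : Subgroup (V ≃ₗ[k] V)) : Set (Submodule k V) :=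
  {H | ∃ s ∈ G, IsReflection s ∧ LinearMap.ker ((s : V →ₗ[k] V) - LinearMap.id) = H}

theorem hyperplanes_finite (G : Subgroup (V ≃ₗ[k] V)) [Finite G] : (hyperplanes G).Finite := by
  have h : (G : Set (V ≃ₗ[k] V)).Finite := Set.toFinite _
  refine (h.image fun s : V ≃ₗ[k] V => LinearMap.ker ((s : V →ₗ[k] V) - LinearMap.id)).subset ?_
  rintro H ⟨s, hs, -, rfl⟩
  exact ⟨s, hs, rfl⟩

/-- The pointwise stabilizer `G_H` of `H` in `G`. -/
def hypStab (G : Subgroup (V ≃ₗ[k] V)) (H : Submodule k V) : Subgroup G :=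
  fixingSubgroup G (H : Set V)

/-- The order `e_H` of `G_H`. -/
def hypOrder (G : Subgroup (V ≃ₗ[k] V)) (H : Submodule k V) : ℕ := Nat.card (hypStab G H)

/-- The determinant of an element of `G` acting on `V`. -/
def detV (G : Subgroup (V ≃ₗ[k] V)) : G →* kˣ := LinearEquiv.det.comp G.subtype

/-- For a representation `N` of `G`, the isotypic component of `N` restricted to `G_H` for the
linear character `det ^ (-j)`. -/
def hypIsotypic (G : Subgroup (V ≃ₗ[k] V)) (H : Submodule k V) {N : Type*} [AddCommGroup N]
    [Module k N] (ρ : Representation k G N) (j : ℕ) : Submodule k N where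
  carrier := {x | ∀ g ∈ hypStab G H, ρ g x = (((detV G g)⁻¹ ^ j : kˣ) : k) • x}
  add_mem' hx hy g hg := by rw [map_add, hx g hg, hy g hg, smul_add]
  zero_mem' g _ := by rw [map_zero, smul_zero]
  smul_mem' c x hx g hg := by rw [map_smul, hx g hg, smul_comm]

/-- `n_{j,H}(N)`: the multiplicity of `det ^ (-j)` in the restriction of `N` to `G_H`. -/
def hypMult (G : Subgroup (V ≃ₗ[k] V)) (H : Submodule k V) {N : Type*} [AddCommGroup N]
    [Module k N] (ρ : Representation k G N) (j : ℕ) : ℕ :=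
  Module.finrank k (hypIsotypic G H ρ j)

/-- `n_H(N)`, the sum of `j * n_{j,H}(N)` over `0 ≤ j < e_H`. -/
def hypWeight (G : Subgroup (V ≃ₗ[k] V)) (H : Submodule k V) {N : Type*} [AddCommGroup N]
    [Module k N] (ρ : Representation k G N) : ℕ :=
  ∑ j ∈ Finset.range (hypOrder G H), j * hypMult G H ρ j

/-- The one-dimensional representation `k_χ`. -/
def charRep {Γ : Type*} [Group Γ] (χ : Γ →* kˣ) : Representation k Γ k where
  toFun g := (χ g : k) • LinearMap.id
  map_one' := by ext; simp
  map_mul' g h := by ext; simp [mul_comm]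

/-- `n_H(χ)`, that is `n_H(k_χ)`. -/
def charWeight (G : Subgroup (V ≃ₗ[k] V)) (H : Submodule k V) (χ : G →* kˣ) : ℕ :=
  hypWeight G H (charRep χ)

/-- The determinant of a representation, as a linear character. -/
def detRep {Γ : Type*} [Group Γ] {N : Type*} [AddCommGroup N] [Module k N]
    (ρ : Representation k Γ N) : Γ →* kˣ :=
  MonoidHom.toHomUnits ((LinearMap.det : (N →ₗ[k] N) →* k).comp ρ)

/-- `H` is `M`-good: `n_H(M) < e_H`. -/
def IsGood (G : Subgroup (V ≃ₗ[k] V)) (H : Submodule k V) {M : Type*} [AddCommGroup M]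
    [Module k M] (ρ : Representation k G M) : Prop :=
  hypWeight G H ρ < hypOrder G H

/-- The family `j` of integers of `[0, e_H - 1]` is such that the restriction of `M` to `G_H` is
the direct sum of the `det ^ (-j i)`. -/
def IsExponentFamily (G : Subgroup (V ≃ₗ[k] V)) (H : Submodule k V) {M : Type*} [AddCommGroup M]
    [Module k M] (ρ : Representation k G M) {r : ℕ} (j : Fin r → ℕ) : Prop :=
  (∀ i, j i < hypOrder G H) ∧
    ∃ b : Module.Basis (Fin r) k M, ∀ i, b i ∈ hypIsotypic G H ρ (j i)

/-- `H` is `(M, χ)`-acceptable: for every partition of the index set `{1, …, r}` into two parts,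
one of the two partial sums of the exponents is smaller than `e_H - n_H(χ)`. -/
def IsAcceptable (G : Subgroup (V ≃ₗ[k] V)) (H : Submodule k V) {M : Type*} [AddCommGroup M]
    [Module k M] (ρ : Representation k G M) (χ : G →* kˣ) : Prop :=
  ∀ j : Fin (Module.finrank k M) → ℕ, IsExponentFamily G H ρ j →
    ∀ I₁ I₂ : Finset (Fin (Module.finrank k M)), Disjoint I₁ I₂ → I₁ ∪ I₂ = Finset.univ →
      ∑ i ∈ I₁, (j i : ℤ) < (hypOrder G H : ℤ) - charWeight G H χ ∨
        ∑ i ∈ I₂, (j i : ℤ) < (hypOrder G H : ℤ) - charWeight G H χ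

end Hyperplanes

/-! ### The rings `S(V*)`, `T⁻¹ S(V*)` and `(T^G)⁻¹ S(V*)^G` -/

section Rings

variable {k : Type*} [Field k] {V : Type*} [AddCommGroup V] [Module k V]

variable (k V) in
/-- The algebra `S(V*)` of polynomial functions. -/
abbrev PolyFun := SymmetricAlgebra k (Module.Dual k V)

/-- The data of a linear form `α H` with kernel `H` for each hyperplane `H` of `G`, and of a
`G`-stable set `B` of hyperplanes of `G`. -/
structure IsBadData (G : Subgroup (V ≃ₗ[k] V)) (α : Submodule k V → Module.Dual k V)
    (B : Set (Submodule k V)) : Prop where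
  ker_eq : ∀ H ∈ hyperplanes G, LinearMap.ker (α H) = H
  subset : B ⊆ hyperplanes G
  stable : ∀ g ∈ G, ∀ H ∈ B, H.map (g : V →ₗ[k] V) ∈ B

/-- The action of `G` on `V*`: `(g f)(v) = f (g⁻¹ v)`. -/
def dualRep (G : Subgroup (V ≃ₗ[k] V)) : Representation k G (Module.Dual k V) :=
  (Representation.ofDistribMulAction k G V).dual

/-- The action of `G` on `S(V*)` by algebra morphisms. -/
def polyAct (G : Subgroup (V ≃ₗ[k] V)) (g : G) : PolyFun k V →ₐ[k] PolyFun k V :=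
  SymmetricAlgebra.lift (SymmetricAlgebra.ι k (Module.Dual k V) ∘ₗ dualRep G g)

/-- The ring of invariants `R = S(V*)^G`. -/
def invariantRing (G : Subgroup (V ≃ₗ[k] V)) : Subalgebra k (PolyFun k V) where
  carrier := {P | ∀ g : G, polyAct G g P = P}
  add_mem' ha hb g := by rw [map_add, ha g, hb g]
  mul_mem' ha hb g := by rw [map_mul, ha g, hb g]
  algebraMap_mem' c g := by rw [AlgHom.commutes]

/-- The multiplicative set `T` generated by the `α H`, for `H` in `B`. -/
def badMonoid (α : Submodule k V → Module.Dual k V) (B : Set (Submodule k V)) :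
    Submonoid (PolyFun k V) :=
  Submonoid.closure ((fun H => SymmetricAlgebra.ι k (Module.Dual k V) (α H)) '' B)

/-- The ring `(T^G)⁻¹ R`, as a subring of the localization `A = T⁻¹ S(V*)`: the set of the
fractions `a / t` with `a` in `R` and `t` a `G`-invariant element of `T`. -/
def locInvariants (G : Subgroup (V ≃ₗ[k] V)) (α : Submodule k V → Module.Dual k V)
    (B : Set (Submodule k V)) (A : Type*) [CommRing A] [Algebra (PolyFun k V) A]
    [IsLocalization (badMonoid α B) A] : Subring A where
  carrier := {x | ∃ a ∈ invariantRing G, ∃ t : badMonoid α B,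
    (t : PolyFun k V) ∈ invariantRing G ∧ x = IsLocalization.mk' A a t}
  zero_mem' := ⟨0, zero_mem _, 1, one_mem _, (IsLocalization.mk'_zero _).symm⟩
  one_mem' := ⟨1, one_mem _, 1, one_mem _, (IsLocalization.mk'_one A 1 |>.trans (map_one _)).symm⟩
  add_mem' := by
    rintro _ _ ⟨a, ha, t, ht, rfl⟩ ⟨b, hb, u, hu, rfl⟩
    exact ⟨a * u + b * t, add_mem (mul_mem ha hu) (mul_mem hb ht), t * u, mul_mem ht hu,
      (IsLocalization.mk'_add _ _ _ _).symm⟩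
  mul_mem' := by
    rintro _ _ ⟨a, ha, t, ht, rfl⟩ ⟨b, hb, u, hu, rfl⟩
    exact ⟨a * b, mul_mem ha hb, t * u, mul_mem ht hu, (IsLocalization.mk'_mul _ _ _ _ _).symm⟩
  neg_mem' := by
    rintro _ ⟨a, ha, t, ht, rfl⟩
    exact ⟨-a, neg_mem ha, t, ht, (IsLocalization.mk'_neg A a t).symm⟩

variable {G : Subgroup (V ≃ₗ[k] V)} {α : Submodule k V → Module.Dual k V}
  {B : Set (Submodule k V)}

theorem hyperplane_ne_top {H : Submodule k V} (hH : H ∈ hyperplanes G) :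
    H ≠ ⊤ := by
  rintro rfl
  obtain ⟨s, -, hs, h⟩ := hH
  have h1 := hs.2
  rw [h, finrank_top] at h1
  omega

/-- An element of `G` sends `α H` to a nonzero multiple of `α (g H)`. -/
theorem dualRep_form (h : IsBadData G α B) (g : G) {H : Submodule k V} (hH : H ∈ B) :
    ∃ c : k, c ≠ 0 ∧
      dualRep G g (α H) = c • α (H.map ((g : V ≃ₗ[k] V) : V →ₗ[k] V)) := by
  have hgH := h.stable g g.2 H hH
  have hk := h.ker_eq H (h.subset hH)
  have hk' := h.ker_eq _ (h.subset hgH)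
  have hle : LinearMap.ker (α (H.map ((g : V ≃ₗ[k] V) : V →ₗ[k] V))) ≤
      LinearMap.ker (dualRep G g (α H)) := by
    rw [hk']
    rintro _ ⟨x, hx, rfl⟩
    have hx' : α H x = 0 := by rw [← LinearMap.mem_ker, hk]; exact hx
    have : g⁻¹ • ((g : V ≃ₗ[k] V) x) = x := inv_smul_smul g x
    simpa [dualRep, Representation.dual_apply, Module.Dual.transpose_apply, this] using hx'
  have hsp := mem_span_of_iInf_ker_le_ker
    (L := fun _ : Unit => α (H.map ((g : V ≃ₗ[k] V) : V →ₗ[k] V))) (by simpa using hle)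
  rw [Set.range_const, Submodule.mem_span_singleton] at hsp
  obtain ⟨c, hc⟩ := hsp
  refine ⟨c, ?_, hc.symm⟩
  rintro rfl
  rw [zero_smul] at hc
  have hinj : Function.Injective (dualRep G g) :=
    ((dualRep G).apply_bijective g).injective
  have h0 : α H = 0 := hinj (by rw [← hc, map_zero])
  rw [h0, LinearMap.ker_zero] at hk
  exact hyperplane_ne_top (h.subset hH) hk.symm

/-- The polynomial `Q_χ`: the product over the hyperplanes `H` of the `(α H) ^ n_H(χ)`. -/
def Qpoly (G : Subgroup (V ≃ₗ[k] V)) [Finite G] (α : Submodule k V → Module.Dual k V)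
    (χ : G →* kˣ) : PolyFun k V :=
  ∏ H ∈ (hyperplanes_finite G).toFinset,
    SymmetricAlgebra.ι k (Module.Dual k V) (α H) ^ charWeight G H χ

variable (A : Type*) [CommRing A] [Algebra k A] [Algebra (PolyFun k V) A]
  [IsScalarTower k (PolyFun k V) A] [IsLocalization (badMonoid α B) A]

/-- The elements of `G` send `T` into the units of `A = T⁻¹ S(V*)`. -/
theorem isUnit_polyAct (h : IsBadData G α B) (g : G) (t : badMonoid α B) :
    IsUnit (((IsScalarTower.toAlgHom k (PolyFun k V) A).comp (polyAct G g)) (t : PolyFun k V)) := by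
  obtain ⟨t, ht⟩ := t
  induction ht using Submonoid.closure_induction with
  | one => rw [map_one]; exact isUnit_one
  | mul x y _ _ hx hy => rw [map_mul]; exact hx.mul hy
  | mem x hx =>
    obtain ⟨H, hH, rfl⟩ := hx
    obtain ⟨c, hc, hcH⟩ := dualRep_form h g hH
    have h1 : IsUnit (algebraMap (PolyFun k V) A (SymmetricAlgebra.ι k (Module.Dual k V)
        (α (H.map ((g : V ≃ₗ[k] V) : V →ₗ[k] V))))) :=
      IsLocalization.map_units A
        (⟨_, Submonoid.subset_closure ⟨_, h.stable g g.2 H hH, rfl⟩⟩ : badMonoid α B)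
    have h2 : IsUnit (algebraMap k A c) := (isUnit_iff_ne_zero.2 hc).map _
    have e : polyAct G g (SymmetricAlgebra.ι k (Module.Dual k V) (α H)) =
        c • SymmetricAlgebra.ι k (Module.Dual k V)
          (α (H.map ((g : V ≃ₗ[k] V) : V →ₗ[k] V))) := by
      rw [polyAct, SymmetricAlgebra.lift_ι_apply, LinearMap.comp_apply, hcH, map_smul]
    rw [AlgHom.comp_apply]
    dsimp only
    rw [e, map_smul, Algebra.smul_def]
    exact h2.mul h1

/-- The action of `G` on `A = T⁻¹ S(V*)`: the extension of its action on `S(V*)`. -/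
def locAct (h : IsBadData G α B) (g : G) : A →ₐ[k] A :=
  IsLocalization.liftAlgHom (M := badMonoid α B)
    (f := (IsScalarTower.toAlgHom k (PolyFun k V) A).comp (polyAct G g)) (isUnit_polyAct A h g)

theorem locAct_algebraMap (h : IsBadData G α B) (g : G) (P : PolyFun k V) :
    locAct A h g (algebraMap _ A P) = algebraMap _ A (polyAct G g P) :=
  IsLocalization.lift_eq _ P

theorem locAct_eq_self (h : IsBadData G α B) (g : G) {x : A} (hx : x ∈ locInvariants G α B A) :
    locAct A h g x = x := by
  obtain ⟨a, ha, t, ht, rfl⟩ := hx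
  have e : IsLocalization.mk' A a t * algebraMap _ A (t : PolyFun k V) = algebraMap _ A a :=
    IsLocalization.mk'_spec _ _ _
  refine (IsLocalization.map_units A t).mul_right_cancel ?_
  have e' := congrArg (locAct A h g) e
  rw [map_mul, locAct_algebraMap, locAct_algebraMap, ht g, ha g] at e'
  rw [e', e]

end Rings

/-! ### The module `Ω = T⁻¹ S(V*) ⊗ Λ(M*)` and the twisted product -/

section Forms

variable {k : Type*} [Field k] {V : Type*} [AddCommGroup V] [Module k V]
  {G : Subgroup (V ≃ₗ[k] V)} {α : Submodule k V → Module.Dual k V} {B : Set (Submodule k V)}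
  (A : Type*) [CommRing A] [Algebra k A] {M : Type*} [AddCommGroup M] [Module k M]

variable (k M) in
/-- The algebra `Ω = A ⊗ Λ(M*)`, for `A = T⁻¹ S(V*)`; its multiplication is the exterior
product. -/
abbrev Forms := A ⊗[k] ExteriorAlgebra k (Module.Dual k M)

variable (k M) in
/-- `Ω^p = A ⊗ Λ^p(M*)`. -/
def formsDeg (p : ℕ) : Submodule A (Forms k A M) :=
  Submodule.baseChange A (⋀[k]^p (Module.Dual k M))

variable [Algebra (PolyFun k V) A] [IsScalarTower k (PolyFun k V) A]
  [IsLocalization (badMonoid α B) A]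

/-- The diagonal action of `G` on `Ω`; `G` acts on `M*` by the contragredient representation. -/
def formsAct (h : IsBadData G α B) (ρ : Representation k G M) (g : G) :
    Forms k A M →ₐ[k] Forms k A M :=
  Algebra.TensorProduct.map (locAct A h g) (ExteriorAlgebra.map (ρ.dual g))

theorem formsAct_smul (h : IsBadData G α B) (ρ : Representation k G M) (g : G) (a : A)
    (x : Forms k A M) :
    formsAct A h ρ g (a • x) = locAct A h g a • formsAct A h ρ g x := by
  induction x using TensorProduct.induction_on with
  | zero => simp only [smul_zero, map_zero]
  | add x y hx hy => simp only [smul_add, map_add, hx, hy]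
  | tmul b y => simp only [formsAct, TensorProduct.smul_tmul', Algebra.TensorProduct.map_tmul,
      smul_eq_mul, map_mul]

/-- `Ω^χ`, as a module over `(T^G)⁻¹ R`. -/
def formsChi (h : IsBadData G α B) (ρ : Representation k G M) (χ : G →* kˣ) :
    Submodule (locInvariants G α B A) (Forms k A M) where
  carrier := {x | ∀ g : G, formsAct A h ρ g x = (χ g : k) • x}
  add_mem' hx hy g := by rw [map_add, hx g, hy g, smul_add]
  zero_mem' g := by rw [map_zero, smul_zero]
  smul_mem' a x hx g := by
    change formsAct A h ρ g ((a : A) • x) = (χ g : k) • ((a : A) • x)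
    rw [formsAct_smul, locAct_eq_self A h g a.2, hx g, smul_comm]

/-- `(Ω^p)^χ`, as a module over `(T^G)⁻¹ R`. -/
def formsChiDeg (h : IsBadData G α B) (ρ : Representation k G M) (χ : G →* kˣ) (p : ℕ) :
    Submodule (locInvariants G α B A) (Forms k A M) :=
  formsChi A h ρ χ ⊓ (formsDeg k A M p).restrictScalars (locInvariants G α B A)

end Forms

section TwistedProduct

variable {k : Type*} [Field k] {V : Type*} [AddCommGroup V] [Module k V]
  {G : Subgroup (V ≃ₗ[k] V)} [Finite G] (α : Submodule k V → Module.Dual k V)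
  (A : Type*) [CommRing A] [Algebra k A] [Algebra (PolyFun k V) A]
  {M : Type*} [AddCommGroup M] [Module k M]

/-- `Q_χ`, as an element of `A = T⁻¹ S(V*)`. -/
def Qloc (χ : G →* kˣ) : A := algebraMap (PolyFun k V) A (Qpoly G α χ)

variable {A}

open Classical in
/-- The twisted product of `μ` and `ω`: the form `ν` such that `Q_χ ν = μ ∧ ω`, with the
convention that it is `0` if there is no such form. -/
def twistedMul (χ : G →* kˣ) (μ ω : Forms k A M) : Forms k A M :=
  if hν : ∃ ν : Forms k A M, Qloc α A χ • ν = μ * ω then hν.choose else 0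

/-- The iterated twisted product of a list of forms; `Q_χ` is the unit of the twisted product. -/
def twistedProd (χ : G →* kˣ) (l : List (Forms k A M)) : Forms k A M :=
  l.foldr (twistedMul α χ) (Qloc α A χ ⊗ₜ[k] 1)

end TwistedProduct

/-- `u ≐ v`: there is a unit `x` of the ring `C` such that `x u = v`. -/
def EqUpToUnit (C : Type*) [Ring C] {U : Type*} [AddCommGroup U] [Module C U] (u v : U) : Prop :=
  ∃ x : Cˣ, (x : C) • u = v

end

end TwistedExterior

open TwistedExterior

/-! Local divisibility. An element of `G_H` acts trivially modulo `α_H` and multiplies `α_H` by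
`det⁻¹`, and `det` is faithful on `G_H`: an element of determinant 1 is a transvection, which has
infinite order in characteristic 0 unless it is trivial. Hence a function on which `G_H` acts by
`det ^ (-m)`, with `m < e_H`, is divisible by `α_H ^ m` (`form_pow_dvd_of_semiinvariant`). The `α_H`
are pairwise non-associated primes and `Q_χ` is itself semi-invariant (`polyAct_Qpoly`), so the
functions of character `χ` are the multiples of `Q_χ` by `(T^G)⁻¹R` (`exists_eq_mul_Qloc`).

The twisted product. For `H` outside `B`, expand `μ` and `ω` along products of a basis of `M*`
adapted to `G_H`. The coefficient of a product with exponent sum `σ` has weight `n_H(χ) + σ`, so it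
is divisible by `α_H ^ n_H(χ)` as soon as this weight is less than `e_H`. Two basis products with
nonzero exterior product have disjoint index sets, and acceptability says that one of the two
coefficients is then divisible (`exists_form_pow_smul_eq_mul`). For `H` in `B`, `α_H` is a unit.

The equivalence. The top degree part of `Ω^χ` is generated over `(T^G)⁻¹R` by `Q_{χ det_M} vol`
(`exists_smul_vol`). If the basis property holds for `p = r`, then `ω₁ ⋏ ⋯ ⋏ ω_r` is another
generator, and the two differ by a unit. Conversely, multiplying a combination of the `p`-fold
products by a complementary product isolates one coefficient, up to sign (`sum_smul_mul_compl`).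
This gives independence. Cramer's rule gives spanning up to a denominator in `A`; and for `x` of
character `χ`, the twisted product of `x` with a complementary product lies in the top degree part,
which forces the coefficients of `x` into `(T^G)⁻¹R` (`span_twistedProd`). -/

namespace TwistedExterior

/-! ### Nonzero linear forms as primes of `S(V*)`. -/

section Polynomials

variable {k : Type*} [Field k] {V : Type*} [AddCommGroup V] [Module k V]

/-- Two algebra morphisms that agree on linear forms modulo an ideal agree modulo this ideal. -/
theorem algHom_sub_mem {C : Type*} [CommRing C] [Algebra k C] (φ ψ : PolyFun k V →ₐ[k] C)
    (I : Ideal C) (h : ∀ β : Module.Dual k V,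
      φ (SymmetricAlgebra.ι k _ β) - ψ (SymmetricAlgebra.ι k _ β) ∈ I) (f : PolyFun k V) :
    φ f - ψ f ∈ I := by
  have e : (Ideal.Quotient.mkₐ k I).comp φ = (Ideal.Quotient.mkₐ k I).comp ψ := by
    apply SymmetricAlgebra.algHom_ext
    ext β
    exact Ideal.Quotient.eq.2 (h β)
  exact Ideal.Quotient.eq.1 (DFunLike.congr_fun e f)

/-- Evaluation of a polynomial function at a point. -/
noncomputable def evalAt (v : V) : PolyFun k V →ₐ[k] k :=
  SymmetricAlgebra.lift (Module.Dual.eval k V v)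

@[simp] theorem evalAt_ι (v : V) (β : Module.Dual k V) :
    evalAt v (SymmetricAlgebra.ι k _ β) = β v := by
  simp [evalAt]

theorem ι_ne_zero {β : Module.Dual k V} (hβ : β ≠ 0) : SymmetricAlgebra.ι k _ β ≠ 0 := by
  intro h
  apply hβ
  ext v
  rw [← evalAt_ι v β, h, map_zero, LinearMap.zero_apply]

/-- For `β u ≠ 0`, the substitution `γ ↦ γ - (γ u / β u) β` kills `β` and is the identity modulo
`β`. So the ideal of `β` is the kernel of an endomorphism of a domain. -/
theorem prime_ι {β : Module.Dual k V} (hβ : β ≠ 0) :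
    Prime (SymmetricAlgebra.ι k _ β) := by
  obtain ⟨u, hu⟩ : ∃ u, β u ≠ 0 := by
    by_contra! h
    exact hβ (LinearMap.ext h)
  obtain ⟨φ, hφ⟩ : ∃ φ : PolyFun k V →ₐ[k] PolyFun k V, ∀ γ : Module.Dual k V,
      φ (SymmetricAlgebra.ι k _ γ) =
        SymmetricAlgebra.ι k _ (γ - (γ u / β u) • β) := by
    refine ⟨SymmetricAlgebra.lift (SymmetricAlgebra.ι k _ ∘ₗ
      (LinearMap.id - ((β u)⁻¹ • Module.Dual.eval k V u).smulRight β)), fun γ => ?_⟩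
    simp [div_eq_inv_mul]
  have h0 : φ (SymmetricAlgebra.ι k _ β) = 0 := by
    rw [hφ, div_self hu, one_smul, sub_self, map_zero]
  have key (f : PolyFun k V) : SymmetricAlgebra.ι k _ β ∣ f ↔ φ f = 0 := by
    constructor
    · rintro ⟨g, rfl⟩
      rw [map_mul, h0, zero_mul]
    · intro hf
      have := algHom_sub_mem (AlgHom.id k _) φ (Ideal.span {SymmetricAlgebra.ι k _ β})
        (fun γ => by
          rw [hφ, AlgHom.id_apply, ← map_sub, sub_sub_cancel, map_smul, Algebra.smul_def]
          exact Ideal.mul_mem_left _ _ (Ideal.mem_span_singleton_self _)) f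
      rwa [hf, sub_zero, AlgHom.id_apply, Ideal.mem_span_singleton] at this
  refine ⟨ι_ne_zero hβ, fun h => ?_, fun a b hab => ?_⟩
  · have := h.map φ
    rw [h0] at this
    exact not_isUnit_zero this
  · rw [key, map_mul, mul_eq_zero] at hab
    rwa [key, key]

theorem not_ι_dvd_ι {β γ : Module.Dual k V} (h : ¬ LinearMap.ker β ≤ LinearMap.ker γ) :
    ¬ SymmetricAlgebra.ι k _ β ∣ SymmetricAlgebra.ι k _ γ := by
  rintro ⟨c, hc⟩
  apply h
  intro v hv
  have := congrArg (evalAt v) hc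
  rwa [map_mul, evalAt_ι, evalAt_ι, LinearMap.mem_ker.1 hv, zero_mul] at this

end Polynomials

/-! ### Pointwise stabilizers of hyperplanes and their characters. -/

section Stabilizers

variable {k : Type*} [Field k] {V : Type*} [AddCommGroup V] [Module k V]
  {G : Subgroup (V ≃ₗ[k] V)}

theorem dualRep_apply (g : G) (β : Module.Dual k V) (v : V) :
    dualRep G g β v = β ((g⁻¹ : V ≃ₗ[k] V) v) := rfl

theorem dualRep_apply_apply (g : G) (β : Module.Dual k V) (v : V) :
    dualRep G g β ((g : V ≃ₗ[k] V) v) = β v := by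
  rw [dualRep_apply]
  exact congrArg β (inv_smul_smul (g : V ≃ₗ[k] V) v)

theorem polyAct_ι (g : G) (β : Module.Dual k V) :
    polyAct G g (SymmetricAlgebra.ι k _ β) = SymmetricAlgebra.ι k _ (dualRep G g β) := by
  simp [polyAct]

theorem polyAct_mul (g h : G) (f : PolyFun k V) :
    polyAct G (g * h) f = polyAct G g (polyAct G h f) := by
  have : polyAct G (g * h) = (polyAct G g).comp (polyAct G h) := by
    apply SymmetricAlgebra.algHom_ext
    ext β
    simp [polyAct_ι]
  rw [this, AlgHom.comp_apply]

theorem polyAct_one (f : PolyFun k V) : polyAct G 1 f = f := by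
  have : polyAct G 1 = AlgHom.id k _ := by
    apply SymmetricAlgebra.algHom_ext
    ext β
    simp [polyAct_ι]
  rw [this, AlgHom.id_apply]

theorem mem_hypStab {H : Submodule k V} {g : G} :
    g ∈ hypStab G H ↔ ∀ v ∈ H, (g : V ≃ₗ[k] V) v = v := by
  rw [hypStab, mem_fixingSubgroup_iff]
  rfl

section Form

variable {H : Submodule k V} {a : Module.Dual k V} (ha : LinearMap.ker a = H) (hH : H ≠ ⊤)

include ha hH in
theorem form_ne_zero : a ≠ 0 := by
  rintro rfl
  exact hH (ha ▸ LinearMap.ker_zero)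

include ha hH in
theorem exists_form_eq_one : ∃ u, a u = 1 := by
  obtain ⟨u, hu⟩ := DFunLike.ne_iff.1 (form_ne_zero ha hH)
  exact ⟨(a u)⁻¹ • u, by simpa using inv_mul_cancel₀ hu⟩

include ha hH in
/-- An element of `G_H` is of the form `v ↦ v + α_H(v) w`. -/
theorem exists_transvection {g : G} (hg : g ∈ hypStab G H) :
    ∃ w, ∀ v, (g : V ≃ₗ[k] V) v = v + a v • w := by
  obtain ⟨u, hu⟩ := exists_form_eq_one ha hH
  refine ⟨(g : V ≃ₗ[k] V) u - u, fun v => ?_⟩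
  have h1 : v - a v • u ∈ H := by
    rw [← ha, LinearMap.mem_ker, map_sub, map_smul, hu, smul_eq_mul, mul_one, sub_self]
  have h2 := mem_hypStab.1 hg _ h1
  rw [map_sub, map_smul] at h2
  rw [smul_sub]
  rw [sub_eq_iff_eq_add.1 h2]
  abel

theorem detV_eq [FiniteDimensional k V] {g : G} {w : V}
    (hw : ∀ v, (g : V ≃ₗ[k] V) v = v + a v • w) : (detV G g : k) = 1 + a w := by
  rw [← LinearMap.transvection.det]
  refine (LinearEquiv.coe_det (g : V ≃ₗ[k] V)).trans ?_
  congr 1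
  ext v
  rw [LinearMap.transvection.apply, ← hw v]
  rfl

-- Evaluate at `g v`: `a (g v) = (1 + a w) a v`, and `1 + a w` is the determinant of `g`. This
-- inverse is why weights are counted in powers of `det⁻¹`.
include ha hH in
theorem dualRep_form_of_mem [FiniteDimensional k V] {g : G} (hg : g ∈ hypStab G H) :
    dualRep G g a = (((detV G g)⁻¹ : kˣ) : k) • a := by
  obtain ⟨w, hw⟩ := exists_transvection ha hH hg
  ext v
  obtain ⟨v, rfl⟩ := (g : V ≃ₗ[k] V).surjective v
  rw [dualRep_apply_apply, LinearMap.smul_apply, hw, map_add, map_smul, smul_eq_mul, smul_eq_mul,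
    ← mul_one_add, ← detV_eq hw, mul_comm, mul_assoc, Units.mul_inv, mul_one]

include ha hH in
theorem dualRep_sub_mem {g : G} (hg : g ∈ hypStab G H) (β : Module.Dual k V) :
    ∃ c : k, dualRep G g β - β = c • a := by
  obtain ⟨w, hw⟩ := exists_transvection ha hH (inv_mem hg)
  refine ⟨β w, ?_⟩
  ext v
  rw [LinearMap.sub_apply, dualRep_apply, LinearMap.smul_apply, smul_eq_mul]
  have := hw v
  rw [Subgroup.coe_inv] at this
  rw [this, map_add, map_smul, smul_eq_mul]
  ring

-- If `det g = 1` then `a w = 0`, so `g ^ n` is `v ↦ v + n a(v) w`; finite order and characteristic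
-- 0 force `w = 0`.
include ha hH in
theorem detV_injOn [CharZero k] [FiniteDimensional k V] [Finite G] :
    Function.Injective ((detV G).comp (hypStab G H).subtype) := by
  rw [injective_iff_map_eq_one]
  rintro ⟨g, hg⟩ h1
  obtain ⟨w, hw⟩ := exists_transvection ha hH hg
  have h2 : a w = 0 := by
    have h3 : (detV G g : k) = 1 := congrArg Units.val h1
    rw [detV_eq hw] at h3
    simpa using h3
  have hpow (n : ℕ) (v : V) : ((g ^ n : G) : V ≃ₗ[k] V) v = v + (n : k) • a v • w := by
    induction n with
    | zero => simp
    | succ n ih =>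
      rw [pow_succ', Subgroup.coe_mul, LinearEquiv.mul_apply, ih, hw, map_add, map_smul, map_smul,
        h2, smul_zero, smul_zero, add_zero]
      push_cast
      rw [add_smul, one_smul, add_assoc]
  obtain ⟨u, hu⟩ := exists_form_eq_one ha hH
  have h3 := hpow (orderOf g) u
  rw [pow_orderOf_eq_one, hu, one_smul] at h3
  have h4 : ((orderOf g : ℕ) : k) • w = 0 := by simpa using h3
  rw [smul_eq_zero, Nat.cast_eq_zero, or_iff_right (orderOf_pos g).ne'] at h4
  apply Subtype.ext
  apply Subtype.ext
  ext v
  rw [hw v, h4]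
  simp

end Form

/-- Through the determinant, `G_H` is a finite subgroup of the multiplicative group of a field,
hence cyclic. -/
theorem exists_generator [CharZero k] [FiniteDimensional k V] [Finite G] {H : Submodule k V}
    {a : Module.Dual k V} (ha : LinearMap.ker a = H) (hH : H ≠ ⊤) :
    ∃ s ∈ hypStab G H, (∀ g ∈ hypStab G H, ∃ n : ℕ, g = s ^ n) ∧
      IsPrimitiveRoot (detV G s : k) (hypOrder G H) ∧ s ^ hypOrder G H = 1 := by
  have hinj := detV_injOn (G := G) ha hH
  have : IsCyclic (hypStab G H) := by
    refine isCyclic_of_injective_ringHom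
      ((Units.coeHom k).comp ((detV G).comp (hypStab G H).subtype)) ?_
    exact Units.val_injective.comp hinj
  obtain ⟨⟨s, hs⟩, hgen⟩ := IsCyclic.exists_generator (α := hypStab G H)
  have ho : orderOf (⟨s, hs⟩ : hypStab G H) = hypOrder G H :=
    orderOf_eq_card_of_forall_mem_zpowers hgen
  refine ⟨s, hs, fun g hg => ?_, ?_, ?_⟩
  · obtain ⟨n, hn⟩ := mem_powers_iff_mem_zpowers.2 (hgen ⟨g, hg⟩)
    exact ⟨n, (congrArg Subtype.val hn).symm⟩
  · rw [IsPrimitiveRoot.coe_units_iff, ← ho, ← orderOf_injective _ hinj]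
    exact IsPrimitiveRoot.orderOf _
  · have := pow_orderOf_eq_one (⟨s, hs⟩ : hypStab G H)
    rw [ho] at this
    exact congrArg Subtype.val this

theorem hypOrder_pos [Finite G] (H : Submodule k V) : 0 < hypOrder G H := Nat.card_pos

/-- The value of `χ` at a generator `s` is an `e_H`-th root of unity, hence a power of the primitive
root `(det s)⁻¹`. -/
theorem exists_pow_detV [CharZero k] [FiniteDimensional k V] [Finite G] {H : Submodule k V}
    {a : Module.Dual k V} (ha : LinearMap.ker a = H) (hH : H ≠ ⊤) (χ : G →* kˣ) :
    ∃ j < hypOrder G H, ∀ g ∈ hypStab G H, χ g = (detV G g)⁻¹ ^ j := by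
  obtain ⟨s, hs, hgen, hprim, hse⟩ := exists_generator (G := G) ha hH
  have : NeZero (hypOrder G H) := ⟨(hypOrder_pos H).ne'⟩
  obtain ⟨j, hj, hjs⟩ := hprim.inv.eq_pow_of_pow_eq_one (ξ := (χ s : k)) (by
    rw [← Units.val_pow_eq_pow_val, ← map_pow, hse, map_one, Units.val_one])
  refine ⟨j, hj, fun g hg => ?_⟩
  obtain ⟨n, rfl⟩ := hgen g hg
  have hs' : χ s = (detV G s)⁻¹ ^ j := by
    apply Units.ext
    rw [← hjs]
    simp
  rw [map_pow, map_pow, hs', ← inv_pow, ← pow_mul, ← pow_mul, mul_comm]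

theorem pow_detV_inj [CharZero k] [FiniteDimensional k V] [Finite G] {H : Submodule k V}
    {a : Module.Dual k V} (ha : LinearMap.ker a = H) (hH : H ≠ ⊤) {i j : ℕ}
    (hi : i < hypOrder G H) (hj : j < hypOrder G H)
    (hij : ∀ g ∈ hypStab G H, ((detV G g)⁻¹ ^ i : kˣ) = (detV G g)⁻¹ ^ j) : i = j := by
  obtain ⟨s, hs, hgen, hprim, hse⟩ := exists_generator (G := G) ha hH
  refine hprim.inv.pow_inj hi hj ?_
  have := congrArg Units.val (hij s hs)
  simpa using this

/-- The restriction of `χ` to `G_H` is `det ^ (- n_H(χ))`. -/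
theorem charWeight_spec [CharZero k] [FiniteDimensional k V] [Finite G] {H : Submodule k V}
    {a : Module.Dual k V} (ha : LinearMap.ker a = H) (hH : H ≠ ⊤) (χ : G →* kˣ) :
    charWeight G H χ < hypOrder G H ∧
      ∀ g ∈ hypStab G H, χ g = (detV G g)⁻¹ ^ charWeight G H χ := by
  obtain ⟨j, hj, hχ⟩ := exists_pow_detV ha hH χ
  suffices charWeight G H χ = j by rw [this]; exact ⟨hj, hχ⟩
  -- `k_χ` is a line, so a single isotypic component is nonzero and the weighted sum is its index.
  rw [charWeight, hypWeight, Finset.sum_eq_single_of_mem j (Finset.mem_range.2 hj)]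
  · have : hypIsotypic G H (charRep χ) j = ⊤ := by
      rw [eq_top_iff]
      intro x _ g hg
      rw [← hχ g hg]
      rfl
    rw [hypMult, this, finrank_top, Module.finrank_self, mul_one]
  · intro i hi hij
    have : hypIsotypic G H (charRep χ) i = ⊥ := by
      rw [eq_bot_iff]
      intro x hx
      by_contra hx0
      refine hij (pow_detV_inj ha hH (Finset.mem_range.1 hi) hj fun g hg => ?_)
      have h1 : (χ g : k) * x = (((detV G g)⁻¹ ^ i : kˣ) : k) * x := hx g hg
      rw [← hχ g hg]
      exact Units.ext (mul_right_cancel₀ hx0 h1).symm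
    rw [hypMult, this, finrank_bot, mul_zero]

theorem charWeight_unique [CharZero k] [FiniteDimensional k V] [Finite G] {H : Submodule k V}
    {a : Module.Dual k V} (ha : LinearMap.ker a = H) (hH : H ≠ ⊤) (χ : G →* kˣ) {j : ℕ}
    (hj : j < hypOrder G H) (hχ : ∀ g ∈ hypStab G H, χ g = (detV G g)⁻¹ ^ j) :
    charWeight G H χ = j := by
  obtain ⟨h1, h2⟩ := charWeight_spec (G := G) ha hH χ
  exact pow_detV_inj ha hH h1 hj fun g hg => by rw [← h2 g hg, hχ g hg]

end Stabilizers

theorem smul_sub_self {R N : Type*} [Ring R] [AddCommGroup N] [Module R N] (c : R) (x : N) :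
    c • x - x = (c - 1) • x := by
  rw [sub_smul, one_smul]

/-! ### The action on hyperplanes and the semi-invariance of `Q_χ`. -/

section Hyperplanes

variable {k : Type*} [Field k] {V : Type*} [AddCommGroup V] [Module k V]
  {G : Subgroup (V ≃ₗ[k] V)} {α : Submodule k V → Module.Dual k V} {B : Set (Submodule k V)}

theorem finrank_hyperplane {H : Submodule k V} (hH : H ∈ hyperplanes G) :
    Module.finrank k H + 1 = Module.finrank k V := by
  obtain ⟨s, -, hs, rfl⟩ := hH
  exact hs.2

theorem hyperplane_eq_of_le [FiniteDimensional k V] {H H' : Submodule k V}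
    (hH : H ∈ hyperplanes G) (hH' : H' ∈ hyperplanes G) (h : H ≤ H') : H = H' :=
  Submodule.eq_of_le_of_finrank_eq h (by
    have := finrank_hyperplane hH
    have := finrank_hyperplane hH'
    omega)

theorem map_mem_hyperplanes [Finite G] (g : G) {H : Submodule k V} (hH : H ∈ hyperplanes G) :
    H.map ((g : V ≃ₗ[k] V) : V →ₗ[k] V) ∈ hyperplanes G := by
  obtain ⟨s, hsG, hs, rfl⟩ := hH
  have hker : LinearMap.ker ((((g : V ≃ₗ[k] V) * s * (g : V ≃ₗ[k] V)⁻¹ : V ≃ₗ[k] V) :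
      V →ₗ[k] V) - LinearMap.id) =
      (LinearMap.ker ((s : V →ₗ[k] V) - LinearMap.id)).map
        ((g : V ≃ₗ[k] V) : V →ₗ[k] V) := by
    ext v
    obtain ⟨v, rfl⟩ := (g : V ≃ₗ[k] V).surjective v
    rw [show (g : V ≃ₗ[k] V) v = ((g : V ≃ₗ[k] V) : V →ₗ[k] V) v from rfl,
      Function.Injective.mem_set_image (f := ((g : V ≃ₗ[k] V) : V →ₗ[k] V))
        (s := (LinearMap.ker ((s : V →ₗ[k] V) - LinearMap.id) : Set V))
        (g : V ≃ₗ[k] V).injective |> (Submodule.mem_map.trans <| ·)]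
    have h1 : (g : V ≃ₗ[k] V)⁻¹ ((g : V ≃ₗ[k] V) v) = v := inv_smul_smul (g : V ≃ₗ[k] V) v
    simp only [LinearMap.mem_ker, SetLike.mem_coe, LinearMap.sub_apply, LinearEquiv.coe_coe,
      LinearEquiv.mul_apply, LinearMap.id_apply, sub_eq_zero, h1,
      (g : V ≃ₗ[k] V).injective.eq_iff]
  have hmem : (g : V ≃ₗ[k] V) * s * (g : V ≃ₗ[k] V)⁻¹ ∈ G :=
    mul_mem (mul_mem g.2 hsG) (inv_mem g.2)
  refine ⟨_, hmem, ⟨?_, ?_⟩, hker⟩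
  · exact Submonoid.isOfFinOrder_coe.2
      (isOfFinOrder_of_finite (⟨_, hmem⟩ : G))
  · rw [hker, ← hs.2]
    congr 1
    exact LinearEquiv.finrank_map_eq (g : V ≃ₗ[k] V) _

theorem IsBadData.univ [Finite G] (hB : IsBadData G α B) : IsBadData G α (hyperplanes G) where
  ker_eq := hB.ker_eq
  subset := subset_rfl
  stable g hg _ hH := map_mem_hyperplanes ⟨g, hg⟩ hH

theorem hypStab_map (g : G) (H : Submodule k V) :
    hypStab G (H.map ((g : V ≃ₗ[k] V) : V →ₗ[k] V)) =
      (hypStab G H).map (MulAut.conj g).toMonoidHom := by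
  ext h
  rw [Subgroup.mem_map]
  constructor
  · intro hh
    refine ⟨g⁻¹ * h * g, mem_hypStab.2 fun v hv => ?_, by simp [mul_assoc]⟩
    have := mem_hypStab.1 hh _ ⟨v, hv, rfl⟩
    rw [LinearEquiv.coe_coe] at this
    rw [Subgroup.coe_mul, Subgroup.coe_mul, LinearEquiv.mul_apply, LinearEquiv.mul_apply, this]
    exact inv_smul_smul (g : V ≃ₗ[k] V) v
  · rintro ⟨x, hx, rfl⟩
    rw [mem_hypStab]
    rintro _ ⟨v, hv, rfl⟩
    have h1 : (g : V ≃ₗ[k] V)⁻¹ ((g : V ≃ₗ[k] V) v) = v := inv_smul_smul (g : V ≃ₗ[k] V) v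
    simp [MulAut.conj_apply, LinearEquiv.mul_apply, h1, mem_hypStab.1 hx v hv]

theorem hypOrder_map (g : G) (H : Submodule k V) :
    hypOrder G (H.map ((g : V ≃ₗ[k] V) : V →ₗ[k] V)) = hypOrder G H := by
  rw [hypOrder, hypStab_map]
  exact Subgroup.card_map_of_injective (MulAut.conj g).injective

theorem charWeight_map [CharZero k] [FiniteDimensional k V] [Finite G] (hB : IsBadData G α B)
    (χ : G →* kˣ) (g : G) {H : Submodule k V} (hH : H ∈ hyperplanes G) :
    charWeight G (H.map ((g : V ≃ₗ[k] V) : V →ₗ[k] V)) χ = charWeight G H χ := by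
  have hgH := map_mem_hyperplanes g hH
  obtain ⟨h1, h2⟩ := charWeight_spec (G := G) (hB.ker_eq H hH) (hyperplane_ne_top hH) χ
  refine charWeight_unique (hB.ker_eq _ hgH) (hyperplane_ne_top hgH) χ ?_ ?_
  · rwa [hypOrder_map]
  · rw [hypStab_map]
    rintro _ ⟨x, hx, rfl⟩
    have := h2 x hx
    simpa [MulAut.conj_apply] using this

theorem form_ne_zero_of_mem (hB : IsBadData G α B) {H : Submodule k V}
    (hH : H ∈ hyperplanes G) : α H ≠ 0 :=
  form_ne_zero (hB.ker_eq H hH) (hyperplane_ne_top hH)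

theorem not_form_dvd_form [FiniteDimensional k V] (hB : IsBadData G α B) {H H' : Submodule k V}
    (hH : H ∈ hyperplanes G) (hH' : H' ∈ hyperplanes G) (hne : H ≠ H') :
    ¬ SymmetricAlgebra.ι k _ (α H) ∣ SymmetricAlgebra.ι k _ (α H') :=
  not_ι_dvd_ι fun h => hne (hyperplane_eq_of_le hH hH'
    (by rwa [hB.ker_eq H hH, hB.ker_eq H' hH'] at h))

theorem polyAct_form (hB : IsBadData G α B) (g : G) {H : Submodule k V} (hH : H ∈ B) :
    ∃ c : k, c ≠ 0 ∧ polyAct G g (SymmetricAlgebra.ι k _ (α H)) =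
      c • SymmetricAlgebra.ι k _ (α (H.map ((g : V ≃ₗ[k] V) : V →ₗ[k] V))) := by
  obtain ⟨c, hc, h⟩ := dualRep_form hB g hH
  exact ⟨c, hc, by rw [polyAct_ι, h, map_smul]⟩

theorem map_eq_self_of_mem_hypStab {g : G} {H : Submodule k V} (hg : g ∈ hypStab G H) :
    H.map ((g : V ≃ₗ[k] V) : V →ₗ[k] V) = H := by
  ext v
  constructor
  · rintro ⟨x, hx, rfl⟩
    rw [LinearEquiv.coe_coe, mem_hypStab.1 hg x hx]
    exact hx
  · exact fun hv => ⟨v, hv, mem_hypStab.1 hg v hv⟩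

/-- The source of all divisibility by `α_H`: it suffices to check linear forms, which `g` moves by
multiples of `α_H`. -/
theorem polyAct_sub_mem (hB : IsBadData G α B) {H : Submodule k V} (hH : H ∈ hyperplanes G)
    {g : G} (hg : g ∈ hypStab G H) (f : PolyFun k V) :
    SymmetricAlgebra.ι k _ (α H) ∣ polyAct G g f - f := by
  rw [← Ideal.mem_span_singleton]
  refine algHom_sub_mem (polyAct G g) (AlgHom.id k _) _ (fun β => ?_) f
  obtain ⟨c, hc⟩ := dualRep_sub_mem (hB.ker_eq H hH) (hyperplane_ne_top hH) hg β
  rw [polyAct_ι, AlgHom.id_apply, ← map_sub, hc, map_smul, Algebra.smul_def]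
  exact Ideal.mul_mem_left _ _ (Ideal.mem_span_singleton_self _)

/-- `g` fixes `H` and permutes the other hyperplanes without changing their weights, so the factors
of `Q_χ` other than the one of `H` are only rescaled. -/
theorem polyAct_prod_erase [CharZero k] [FiniteDimensional k V] [Finite G]
    [DecidableEq (Submodule k V)] (hB : IsBadData G α B)
    (χ : G →* kˣ) {H : Submodule k V} {g : G} (hg : g ∈ hypStab G H) :
    ∃ c : k, polyAct G g (∏ H' ∈ (hyperplanes_finite G).toFinset.erase H,
        SymmetricAlgebra.ι k (Module.Dual k V) (α H') ^ charWeight G H' χ) =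
      c • ∏ H' ∈ (hyperplanes_finite G).toFinset.erase H,
        SymmetricAlgebra.ι k (Module.Dual k V) (α H') ^ charWeight G H' χ := by
  choose! c hc0 hc using fun H' (hH' : H' ∈ hyperplanes G) => polyAct_form hB.univ g hH'
  refine ⟨∏ H' ∈ (hyperplanes_finite G).toFinset.erase H, c H' ^ charWeight G H' χ, ?_⟩
  rw [map_prod]
  have e1 : ∀ H' ∈ (hyperplanes_finite G).toFinset.erase H,
      polyAct G g (SymmetricAlgebra.ι k (Module.Dual k V) (α H') ^ charWeight G H' χ) =
      algebraMap k _ (c H' ^ charWeight G H' χ) * (SymmetricAlgebra.ι k (Module.Dual k V)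
        (α (H'.map ((g : V ≃ₗ[k] V) : V →ₗ[k] V))) ^
          charWeight G (H'.map ((g : V ≃ₗ[k] V) : V →ₗ[k] V)) χ) := by
    intro H' hH'
    have hH'' : H' ∈ hyperplanes G := by simpa using Finset.mem_of_mem_erase hH'
    rw [map_pow, hc H' hH'', charWeight_map hB χ g hH'', smul_pow, Algebra.smul_def]
  rw [Finset.prod_congr rfl e1, Finset.prod_mul_distrib, ← map_prod, ← Algebra.smul_def]
  congr 1
  have key (g : G) (hg : g ∈ hypStab G H) (H' : Submodule k V)
      (hH' : H' ∈ (hyperplanes_finite G).toFinset.erase H) :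
      H'.map ((g : V ≃ₗ[k] V) : V →ₗ[k] V) ∈ (hyperplanes_finite G).toFinset.erase H := by
    rw [Finset.mem_erase, Set.Finite.mem_toFinset] at hH' ⊢
    refine ⟨fun h => hH'.1 ?_, map_mem_hyperplanes g hH'.2⟩
    refine Submodule.map_injective_of_injective
      (f := ((g : V ≃ₗ[k] V) : V →ₗ[k] V)) (g : V ≃ₗ[k] V).injective ?_
    rw [h, map_eq_self_of_mem_hypStab hg]
  have hinv (g : G) (H' : Submodule k V) :
      (H'.map ((g : V ≃ₗ[k] V) : V →ₗ[k] V)).map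
        (((g⁻¹ : G) : V ≃ₗ[k] V) : V →ₗ[k] V) = H' := by
    rw [← Submodule.map_comp]
    convert Submodule.map_id H'
    ext v
    exact inv_smul_smul (g : V ≃ₗ[k] V) v
  refine Finset.prod_nbij' (fun H' => H'.map ((g : V ≃ₗ[k] V) : V →ₗ[k] V))
    (fun H' => H'.map (((g⁻¹ : G) : V ≃ₗ[k] V) : V →ₗ[k] V)) (key g hg) (key _ (inv_mem hg))
    (fun H' _ => hinv g H') (fun H' _ => ?_) (fun _ _ => rfl)
  simpa using hinv g⁻¹ H'

/-- `Q_χ` is semi-invariant under the stabilizer of a hyperplane. -/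
theorem polyAct_Qpoly_of_mem_hypStab [CharZero k] [FiniteDimensional k V] [Finite G]
    (hB : IsBadData G α B) (χ : G →* kˣ) {H : Submodule k V} (hH : H ∈ hyperplanes G) {g : G}
    (hg : g ∈ hypStab G H) : polyAct G g (Qpoly G α χ) = (χ g : k) • Qpoly G α χ := by
  classical
  obtain ⟨c, hc⟩ := polyAct_prod_erase hB χ hg
  have hmem : H ∈ (hyperplanes_finite G).toFinset := by simpa using hH
  have hprime := prime_ι (form_ne_zero_of_mem hB hH)
  -- `g` is the identity modulo `α_H`; if `c ≠ 1`, then `α_H` would divide a product of powers of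
  -- the other forms.
  have hc1 : c = 1 := by
    by_contra hne
    have h1 := polyAct_sub_mem hB hH hg (∏ H' ∈ (hyperplanes_finite G).toFinset.erase H,
        SymmetricAlgebra.ι k (Module.Dual k V) (α H') ^ charWeight G H' χ)
    rw [hc, smul_sub_self, Algebra.smul_def] at h1
    have hu : IsUnit (algebraMap k (PolyFun k V) (c - 1)) :=
      (isUnit_iff_ne_zero.2 (sub_ne_zero.2 hne)).map _
    rw [hu.dvd_mul_left] at h1
    obtain ⟨H', hH', h2⟩ := (hprime.dvd_finsetProd_iff _).1 h1
    rw [Finset.mem_erase, Set.Finite.mem_toFinset] at hH'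
    exact not_form_dvd_form hB hH hH'.2 hH'.1.symm (hprime.dvd_of_dvd_pow h2)
  obtain ⟨-, h2⟩ := charWeight_spec (G := G) (hB.ker_eq H hH) (hyperplane_ne_top hH) χ
  rw [Qpoly, ← Finset.mul_prod_erase _ _ hmem, map_mul, hc, hc1, one_smul, map_pow, polyAct_ι,
    dualRep_form_of_mem (hB.ker_eq H hH) (hyperplane_ne_top hH) hg, map_smul, smul_pow, h2 g hg,
    smul_mul_assoc]
  simp

/-- The elements that act on `Q_χ` by `χ` form a subgroup. It contains every reflection, which fixes
its own hyperplane pointwise. -/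
theorem polyAct_Qpoly [CharZero k] [FiniteDimensional k V] [Finite G]
    (hG : Subgroup.closure {s : V ≃ₗ[k] V | s ∈ G ∧ IsReflection s} = G)
    (hB : IsBadData G α B) (χ : G →* kˣ) (g : G) :
    polyAct G g (Qpoly G α χ) = (χ g : k) • Qpoly G α χ := by
  let K : Subgroup G :=
    { carrier := {g | polyAct G g (Qpoly G α χ) = (χ g : k) • Qpoly G α χ}
      one_mem' := by simp [polyAct_one]
      mul_mem' := by
        intro a b ha hb
        simp only [Set.mem_ofPred_eq] at ha hb ⊢
        rw [polyAct_mul, hb, map_smul, ha, smul_smul, map_mul, Units.val_mul, mul_comm]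
      inv_mem' := by
        intro a ha
        simp only [Set.mem_ofPred_eq] at ha ⊢
        have := congrArg (polyAct G a⁻¹) ha
        rw [← polyAct_mul, inv_mul_cancel, polyAct_one, map_smul] at this
        rw [this, smul_smul, map_inv, Units.inv_mul, one_smul, ← this] }
  have hK : G ≤ K.map G.subtype := by
    conv_lhs => rw [← hG]
    rw [Subgroup.closure_le]
    rintro s ⟨hs, hr⟩
    refine ⟨⟨s, hs⟩, ?_, rfl⟩
    refine polyAct_Qpoly_of_mem_hypStab hB χ ⟨s, hs, hr, rfl⟩ (mem_hypStab.2 fun v hv => ?_)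
    exact sub_eq_zero.1 hv
  obtain ⟨x, hx, hxg⟩ := hK g.2
  rwa [← Subtype.ext hxg]

theorem Qpoly_ne_zero [Finite G] (hB : IsBadData G α B) (χ : G →* kˣ) : Qpoly G α χ ≠ 0 := by
  refine Finset.prod_ne_zero_iff.2 fun H hH => pow_ne_zero _ (ι_ne_zero ?_)
  exact form_ne_zero_of_mem hB (by simpa using hH)

end Hyperplanes

/-! ### Divisibility and semi-invariants in `T⁻¹ S(V*)`. -/

section Localization

variable {k : Type*} [Field k] {V : Type*} [AddCommGroup V] [Module k V]
  {G : Subgroup (V ≃ₗ[k] V)} {α : Submodule k V → Module.Dual k V} {B : Set (Submodule k V)}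
  (A : Type*) [CommRing A] [Algebra (PolyFun k V) A] [IsLocalization (badMonoid α B) A]

theorem badMonoid_le (hB : IsBadData G α B) : badMonoid α B ≤ nonZeroDivisors (PolyFun k V) := by
  rw [badMonoid, Submonoid.closure_le]
  rintro _ ⟨H, hH, rfl⟩
  exact mem_nonZeroDivisors_of_ne_zero (ι_ne_zero (form_ne_zero_of_mem hB (hB.subset hH)))

include G in
theorem isDomain_loc (hB : IsBadData G α B) : IsDomain A :=
  IsLocalization.isDomain_of_le_nonZeroDivisors A (badMonoid_le hB)

include G in
theorem algebraMap_loc_injective (hB : IsBadData G α B) :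
    Function.Injective (algebraMap (PolyFun k V) A) :=
  IsLocalization.injective A (badMonoid_le hB)

/-- Clearing denominators reduces this to the primality of `α_H` in `S(V*)`. The argument does not
depend on whether `α_H` has become a unit. -/
theorem dvd_of_dvd_form_mul [FiniteDimensional k V] (hB : IsBadData G α B) {H H' : Submodule k V}
    (hH : H ∈ hyperplanes G) (hH' : H' ∈ hyperplanes G) (hne : H ≠ H') {y : A}
    (h : algebraMap (PolyFun k V) A (SymmetricAlgebra.ι k _ (α H)) ∣
      algebraMap (PolyFun k V) A (SymmetricAlgebra.ι k _ (α H')) * y) :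
    algebraMap (PolyFun k V) A (SymmetricAlgebra.ι k _ (α H)) ∣ y := by
  obtain ⟨z, hz⟩ := h
  obtain ⟨⟨f, t⟩, hy⟩ := IsLocalization.surj (badMonoid α B) y
  obtain ⟨⟨f', t'⟩, hz'⟩ := IsLocalization.surj (badMonoid α B) z
  dsimp only at hy hz'
  have hprime := prime_ι (form_ne_zero_of_mem hB hH)
  have h1 : SymmetricAlgebra.ι k _ (α H') * (f * t') = SymmetricAlgebra.ι k _ (α H) * (f' * t) := by
    apply algebraMap_loc_injective A hB
    simp only [map_mul, ← hy, ← hz']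
    linear_combination (algebraMap (PolyFun k V) A t) * (algebraMap (PolyFun k V) A t') * hz
  have h2 := (hprime.dvd_or_dvd ⟨_, h1⟩).resolve_left (not_form_dvd_form hB hH hH' hne)
  rw [← (IsLocalization.map_units A t).dvd_mul_right, hy,
    ← (IsLocalization.map_units A t').dvd_mul_right, ← map_mul]
  exact map_dvd _ h2

/-- Powers of distinct `α_H` are coprime in the sense that each can be cancelled from multiples of
the others, so their product divides what each of them divides. -/
theorem Qloc_dvd [FiniteDimensional k V] [Finite G] (hB : IsBadData G α B) (χ : G →* kˣ) {x : A}
    (h : ∀ H ∈ hyperplanes G,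
      algebraMap (PolyFun k V) A (SymmetricAlgebra.ι k _ (α H)) ^ charWeight G H χ ∣ x) :
    Qloc α A χ ∣ x := by
  classical
  have := isDomain_loc A hB
  -- If divisibility by `α_H` passes from `c * y` to `y`, so does divisibility by its powers.
  have hpow (H : Submodule k V) (hH : H ∈ hyperplanes G) (c : A)
      (hc : ∀ y, algebraMap (PolyFun k V) A (SymmetricAlgebra.ι k _ (α H)) ∣ c * y →
        algebraMap (PolyFun k V) A (SymmetricAlgebra.ι k _ (α H)) ∣ y) (n : ℕ) (y : A)
      (hy : algebraMap (PolyFun k V) A (SymmetricAlgebra.ι k _ (α H)) ^ n ∣ c * y) :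
      algebraMap (PolyFun k V) A (SymmetricAlgebra.ι k _ (α H)) ^ n ∣ y := by
    have ha0 : algebraMap (PolyFun k V) A (SymmetricAlgebra.ι k _ (α H)) ≠ 0 := by
      rw [Ne, map_eq_zero_iff _ (algebraMap_loc_injective A hB)]
      exact ι_ne_zero (form_ne_zero_of_mem hB hH)
    induction n generalizing y with
    | zero => simp
    | succ n ih =>
      obtain ⟨z, rfl⟩ := hc y ((dvd_pow_self _ n.succ_ne_zero).trans hy)
      rw [pow_succ', mul_left_comm] at hy
      rw [pow_succ']
      exact mul_dvd_mul_left _ (ih z ((mul_dvd_mul_iff_left ha0).1 hy))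
  have key (F : Finset (Submodule k V)) (hF : ∀ H ∈ F, H ∈ hyperplanes G) :
      ∏ H ∈ F, algebraMap (PolyFun k V) A (SymmetricAlgebra.ι k _ (α H)) ^ charWeight G H χ ∣
        x := by
    induction F using Finset.induction_on with
    | empty => simp
    | insert H F hHF ih =>
      rw [Finset.forall_mem_insert] at hF
      obtain ⟨y, hy⟩ := ih hF.2
      rw [Finset.prod_insert hHF, mul_comm]
      rw [hy]
      -- It remains to cancel the product over the other hyperplanes, one linear factor at a time.
      refine mul_dvd_mul_left _ (hpow H hF.1 _ (fun z hz => ?_) _ y (hy ▸ h H hF.1))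
      clear hy ih
      induction F using Finset.induction_on generalizing z with
      | empty => simpa using hz
      | insert H' F hH'F ih =>
        rw [Finset.forall_mem_insert] at hF
        rw [Finset.mem_insert, not_or] at hHF
        rw [Finset.prod_insert hH'F, mul_assoc] at hz
        refine ih hHF.2 ⟨hF.1, hF.2.2⟩ z ?_
        generalize charWeight G H' χ = n at hz
        induction n with
        | zero => simpa using hz
        | succ n ihn =>
          rw [pow_succ', mul_assoc] at hz
          exact ihn (dvd_of_dvd_form_mul A hB hF.1 hF.2.1 hHF.1 hz)
  rw [Qloc, Qpoly, map_prod]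
  simp only [map_pow]
  exact key _ (by simp)

theorem Qloc_ne_zero [Finite G] (hB : IsBadData G α B) (χ : G →* kˣ) : Qloc α A χ ≠ 0 := by
  rw [Qloc, Ne, map_eq_zero_iff _ (algebraMap_loc_injective A hB)]
  exact Qpoly_ne_zero hB χ

variable [Algebra k A]

include α B in
theorem algHom_loc_ext {C : Type*} [CommRing C] [Algebra k C] {φ ψ : A →ₐ[k] C}
    (h : ∀ f : PolyFun k V, φ (algebraMap _ A f) = ψ (algebraMap _ A f)) : φ = ψ := by
  have : (φ : A →+* C) = ψ :=
    IsLocalization.ringHom_ext (badMonoid α B) (RingHom.ext h)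
  exact AlgHom.ext fun x => congrArg (fun f : A →+* C => f x) this

variable [IsScalarTower k (PolyFun k V) A]

theorem algebraMap_loc_smul (c : k) (f : PolyFun k V) :
    algebraMap (PolyFun k V) A (c • f) = c • algebraMap (PolyFun k V) A f :=
  map_smul (IsScalarTower.toAlgHom k (PolyFun k V) A) c f

theorem locAct_mul (hB : IsBadData G α B) (g h : G) :
    locAct A hB (g * h) = (locAct A hB g).comp (locAct A hB h) := by
  refine algHom_loc_ext (α := α) (B := B) A fun f => ?_
  rw [AlgHom.comp_apply, locAct_algebraMap, locAct_algebraMap, locAct_algebraMap, polyAct_mul]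

theorem locAct_sub_mem (hB : IsBadData G α B) {H : Submodule k V} (hH : H ∈ hyperplanes G)
    {g : G} (hg : g ∈ hypStab G H) (x : A) :
    algebraMap (PolyFun k V) A (SymmetricAlgebra.ι k _ (α H)) ∣ locAct A hB g x - x := by
  obtain ⟨⟨f, t⟩, hx⟩ := IsLocalization.surj (badMonoid α B) x
  have hgx := congrArg (locAct A hB g) hx
  dsimp only at hx hgx
  rw [map_mul, locAct_algebraMap, locAct_algebraMap] at hgx
  have ht : IsUnit (algebraMap (PolyFun k V) A t) := IsLocalization.map_units A t
  have hgt : IsUnit (algebraMap (PolyFun k V) A (polyAct G g t)) := by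
    rw [← locAct_algebraMap (B := B) A hB]
    exact ht.map _
  rw [← ht.dvd_mul_right, ← hgt.dvd_mul_right]
  have e : (locAct A hB g x - x) * algebraMap _ A (t : PolyFun k V) *
      algebraMap _ A (polyAct G g t) =
      algebraMap _ A ((polyAct G g f - f) * t - f * (polyAct G g t - t)) := by
    simp only [map_sub, map_mul, ← hgx, ← hx]
    ring
  rw [e]
  refine map_dvd _ (dvd_sub ?_ ?_)
  · exact Dvd.dvd.mul_right (polyAct_sub_mem hB hH hg f) _
  · exact Dvd.dvd.mul_left (polyAct_sub_mem hB hH hg _) _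

/-- A function on which `G_H` acts by `det ^ (-m)` is divisible by `α_H ^ m`. -/
theorem form_pow_dvd_of_semiinvariant [CharZero k] [FiniteDimensional k V] [Finite G]
    (hB : IsBadData G α B) {H : Submodule k V} (hH : H ∈ hyperplanes G) {m : ℕ}
    (hm : m < hypOrder G H) {x : A}
    (hx : ∀ g ∈ hypStab G H, locAct A hB g x = (((detV G g)⁻¹ ^ m : kˣ) : k) • x) :
    algebraMap (PolyFun k V) A (SymmetricAlgebra.ι k _ (α H)) ^ m ∣ x := by
  have := isDomain_loc A hB
  obtain ⟨s, hs, -, hprim, -⟩ :=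
    exists_generator (G := G) (hB.ker_eq H hH) (hyperplane_ne_top hH)
  replace hx := hx s hs
  have ha : locAct A hB s (algebraMap (PolyFun k V) A (SymmetricAlgebra.ι k _ (α H))) =
      (((detV G s)⁻¹ : kˣ) : k) •
        algebraMap (PolyFun k V) A (SymmetricAlgebra.ι k _ (α H)) := by
    rw [locAct_algebraMap, polyAct_ι,
      dualRep_form_of_mem (hB.ker_eq H hH) (hyperplane_ne_top hH) hs, map_smul,
      algebraMap_loc_smul]
  have ha0 : algebraMap (PolyFun k V) A (SymmetricAlgebra.ι k _ (α H)) ≠ 0 := by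
    rw [Ne, map_eq_zero_iff _ (algebraMap_loc_injective A hB)]
    exact ι_ne_zero (form_ne_zero_of_mem hB hH)
  induction m generalizing x with
  | zero => simp
  | succ m ih =>
    have h1 := locAct_sub_mem A hB hH hs x
    rw [hx, smul_sub_self, Algebra.smul_def] at h1
    -- The generator `s` multiplies `x` by `(det s)^(-(m+1))`, which is not 1 since `0 < m + 1 <
    -- e_H`. Thus `α_H` divides `s x - x`, hence `x`, and the quotient has weight `m`.
    have hne : (((detV G s)⁻¹ ^ (m + 1) : kˣ) : k) - 1 ≠ 0 := by
      rw [sub_ne_zero]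
      intro h
      have h2 := hprim.inv.pow_inj hm (hypOrder_pos H) (by simpa using h)
      omega
    rw [((isUnit_iff_ne_zero.2 hne).map (algebraMap k A)).dvd_mul_left] at h1
    obtain ⟨y, rfl⟩ := h1
    rw [pow_succ']
    refine mul_dvd_mul_left _ (ih (by omega) ?_)
    rw [map_mul, ha, smul_mul_assoc, pow_succ', Units.val_mul, mul_smul] at hx
    have h3 := smul_right_injective A (Units.ne_zero (detV G s)⁻¹) hx
    rw [← mul_smul_comm] at h3
    exact mul_left_cancel₀ ha0 h3

theorem locAct_Qloc [CharZero k] [FiniteDimensional k V] [Finite G]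
    (hG : Subgroup.closure {s : V ≃ₗ[k] V | s ∈ G ∧ IsReflection s} = G)
    (hB : IsBadData G α B) (χ : G →* kˣ) (g : G) :
    locAct A hB g (Qloc α A χ) = (χ g : k) • Qloc α A χ := by
  rw [Qloc, locAct_algebraMap, polyAct_Qpoly hG hB, algebraMap_loc_smul]

theorem exists_badMonoid_smul (hB : IsBadData G α B) (g : G) (t : badMonoid α B) :
    ∃ c : k, c ≠ 0 ∧ ∃ u ∈ badMonoid α B, polyAct G g t = c • u := by
  obtain ⟨t, ht⟩ := t
  induction ht using Submonoid.closure_induction with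
  | one => exact ⟨1, one_ne_zero, 1, one_mem _, by simp⟩
  | mul x y _ _ hx hy =>
    obtain ⟨c, hc, u, hu, h⟩ := hx
    obtain ⟨c', hc', u', hu', h'⟩ := hy
    refine ⟨c * c', mul_ne_zero hc hc', u * u', mul_mem hu hu', ?_⟩
    dsimp only at h h' ⊢
    rw [map_mul, h, h', smul_mul_smul_comm]
  | mem x hx =>
    obtain ⟨H, hH, rfl⟩ := hx
    obtain ⟨c, hc, h⟩ := polyAct_form hB g hH
    exact ⟨c, hc, _, Submonoid.subset_closure ⟨_, hB.stable g g.2 H hH, rfl⟩, h⟩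

/-- An element of `T` divides a `G`-invariant element of `T`. -/
theorem exists_invariant_multiple [Finite G] (hB : IsBadData G α B) (t : badMonoid α B) :
    ∃ u ∈ badMonoid α B, u ∈ invariantRing G ∧ (t : PolyFun k V) ∣ u := by
  cases nonempty_fintype G
  choose c hc u hu h using fun g => exists_badMonoid_smul hB g t
  -- The norm of `t` is invariant but lies in `T` only up to a scalar; this scalar is removed here.
  have e : ∏ g, u g = (∏ g, c g)⁻¹ • ∏ g, polyAct G g t := by
    simp_rw [h, Algebra.smul_def]
    rw [Finset.prod_mul_distrib, ← map_prod, ← mul_assoc, ← map_mul,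
      inv_mul_cancel₀ (Finset.prod_ne_zero_iff.2 fun g _ => hc g), map_one, one_mul]
  refine ⟨∏ g, u g, prod_mem fun g _ => hu g, fun g => ?_, ?_⟩
  · rw [e, map_smul, map_prod]
    congr 1
    simp_rw [← polyAct_mul]
    exact Fintype.prod_equiv (Equiv.mulLeft g) _ _ fun _ => rfl
  · rw [e, Algebra.smul_def]
    refine Dvd.dvd.mul_left ?_ _
    have := Finset.dvd_prod_of_mem (fun g => polyAct G g (t : PolyFun k V)) (Finset.mem_univ 1)
    rwa [polyAct_one] at this

/-- Enlarge the denominator to an invariant one; the numerator is then invariant too. -/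
theorem mem_locInvariants [Finite G] (hB : IsBadData G α B) {x : A}
    (hx : ∀ g, locAct A hB g x = x) : x ∈ locInvariants G α B A := by
  obtain ⟨⟨f, t⟩, hft⟩ := IsLocalization.surj (badMonoid α B) x
  dsimp only at hft
  obtain ⟨u, hu, huG, v, rfl⟩ := exists_invariant_multiple hB t
  have e : x * algebraMap (PolyFun k V) A (t * v) = algebraMap (PolyFun k V) A (f * v) := by
    rw [map_mul, map_mul, ← mul_assoc, hft]
  refine ⟨f * v, fun g => ?_, ⟨_, hu⟩, huG, ?_⟩
  · apply algebraMap_loc_injective A hB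
    rw [← locAct_algebraMap (B := B) A hB, ← e, map_mul, hx, locAct_algebraMap, huG g]
  · rw [IsLocalization.eq_mk'_iff_mul_eq]
    exact e

/-- Semi-invariants of character `ψ` are the multiples of `Q_ψ` by invariants. -/
theorem exists_eq_mul_Qloc [CharZero k] [FiniteDimensional k V] [Finite G]
    (hG : Subgroup.closure {s : V ≃ₗ[k] V | s ∈ G ∧ IsReflection s} = G)
    (hB : IsBadData G α B) (ψ : G →* kˣ) {x : A}
    (hx : ∀ g, locAct A hB g x = (ψ g : k) • x) :
    ∃ c ∈ locInvariants G α B A, x = c * Qloc α A ψ := by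
  have := isDomain_loc A hB
  -- Each `α_H` divides `x` to the power prescribed by the restriction of `ψ` to `G_H`; the quotient
  -- by `Q_ψ` is then invariant.
  obtain ⟨c, rfl⟩ : Qloc α A ψ ∣ x := by
    refine Qloc_dvd A hB ψ fun H hH => ?_
    obtain ⟨h1, h2⟩ := charWeight_spec (G := G) (hB.ker_eq H hH) (hyperplane_ne_top hH) ψ
    exact form_pow_dvd_of_semiinvariant A hB hH h1 fun g hg => by rw [hx, h2 g hg]
  refine ⟨c, mem_locInvariants A hB fun g => ?_, mul_comm _ _⟩
  have h1 := hx g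
  rw [map_mul, locAct_Qloc A hG, smul_mul_assoc] at h1
  exact mul_left_cancel₀ (Qloc_ne_zero A hB ψ)
    (smul_right_injective A (Units.ne_zero (ψ g)) h1)

end Localization

/-! ### Products of anticommuting elements along lists. -/

section Lists

variable {C ι : Type*} [Ring C] {w : ι → C}

theorem prod_map_perm (h : ∀ i j, w i * w j = -(w j * w i)) {l l' : List ι} (hl : l.Perm l') :
    (l.map w).prod = (l'.map w).prod ∨ (l.map w).prod = -(l'.map w).prod := by
  induction hl with
  | nil => exact Or.inl rfl
  | cons x _ ih =>
    rcases ih with ih | ih <;> simp [ih]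
  | swap x y l => right; simp [← mul_assoc, h y x]
  | trans _ _ ih ih' => rcases ih with ih | ih <;> rcases ih' with ih' | ih' <;> simp [ih, ih']

theorem prod_map_eq_zero (h0 : ∀ i, w i * w i = 0) (h : ∀ i j, w i * w j = -(w j * w i))
    {l : List ι} (hl : ¬ l.Nodup) : (l.map w).prod = 0 := by
  have key (i : ι) (l : List ι) (hi : i ∈ l) : w i * (l.map w).prod = 0 := by
    induction l with
    | nil => simp at hi
    | cons j l ih =>
      rw [List.map_cons, List.prod_cons, ← mul_assoc]
      rcases List.mem_cons.1 hi with rfl | hi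
      · rw [h0, zero_mul]
      · rw [h, neg_mul, mul_assoc, ih hi, mul_zero, neg_zero]
  induction l with
  | nil => simp at hl
  | cons i l ih =>
    rw [List.map_cons, List.prod_cons]
    by_cases hi : i ∈ l
    · exact key i l hi
    · rw [ih fun h => hl (List.nodup_cons.2 ⟨hi, h⟩), mul_zero]

theorem ι_anticomm {R N : Type*} [CommRing R] [AddCommGroup N] [Module R N] (x y : N) :
    ExteriorAlgebra.ι R x * ExteriorAlgebra.ι R y =
      -(ExteriorAlgebra.ι R y * ExteriorAlgebra.ι R x) :=
  eq_neg_of_add_eq_zero_left (ExteriorAlgebra.ι_add_mul_swap x y)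

/-- The exterior algebra is spanned by the products of elements of a basis. -/
theorem span_prod_basis {R N : Type*} [CommRing R] [AddCommGroup N] [Module R N]
    (e : Module.Basis ι R N) (x : ExteriorAlgebra R N) :
    x ∈ Submodule.span R
      (Set.range fun l : List ι => (l.map fun i => ExteriorAlgebra.ι R (e i)).prod) := by
  induction x using ExteriorAlgebra.induction with
  | algebraMap r =>
    rw [Algebra.algebraMap_eq_smul_one]
    exact Submodule.smul_mem _ _ (Submodule.subset_span ⟨[], by simp⟩)
  | ι v =>
    have hv := e.mem_span v
    induction hv using Submodule.span_induction with
    | mem x hx =>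
      obtain ⟨i, rfl⟩ := hx
      exact Submodule.subset_span ⟨[i], by simp⟩
    | zero => rw [map_zero]; exact zero_mem _
    | add x y _ _ hx hy => rw [map_add]; exact add_mem hx hy
    | smul c x _ hx => rw [map_smul]; exact Submodule.smul_mem _ c hx
  | add a b ha hb => exact add_mem ha hb
  | mul a b ha hb =>
    have := Submodule.mul_mem_mul ha hb
    rw [Submodule.span_mul_span] at this
    refine Submodule.span_mono ?_ this
    rintro _ ⟨_, ⟨l, rfl⟩, _, ⟨l', rfl⟩, rfl⟩
    exact ⟨l ++ l', by simp⟩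

end Lists

/-! ### Endomorphisms on the top exterior power. -/

section Determinant

variable {R N : Type*} [CommRing R] [AddCommGroup N] [Module R N] {r : ℕ}

theorem alternatingMap_eq_det_smul {W : Type*} [AddCommGroup W] [Module R W]
    (b : Module.Basis (Fin r) R N) (F : N [⋀^Fin r]→ₗ[R] W) (v : Fin r → N) :
    F v = b.det v • F b := by
  have : F = (LinearMap.toSpanSingleton R W (F b)).compAlternatingMap b.det := by
    refine Module.Basis.ext_alternating b fun i hi => ?_
    let σ : Equiv.Perm (Fin r) := Equiv.ofBijective i (Finite.injective_iff_bijective.1 hi)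
    have h1 {W : Type _} [AddCommGroup W] [Module R W] (F : N [⋀^Fin r]→ₗ[R] W) :
        F (fun j => b (i j)) = Equiv.Perm.sign σ • F b :=
      AlternatingMap.map_perm F b σ
    rw [h1, h1, LinearMap.compAlternatingMap_apply, b.det_self, LinearMap.toSpanSingleton_apply,
      one_smul]
  exact congrArg (fun F => F v) this

theorem map_eq_det_smul (b : Module.Basis (Fin r) R N) (f : N →ₗ[R] N)
    {x : ExteriorAlgebra R N} (hx : x ∈ ⋀[R]^r N) :
    ExteriorAlgebra.map f x = LinearMap.det f • x := by
  rw [← ExteriorAlgebra.ιMulti_span_fixedDegree] at hx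
  induction hx using Submodule.span_induction with
  | mem x hx =>
    obtain ⟨v, rfl⟩ := hx
    rw [ExteriorAlgebra.map_apply_ιMulti, alternatingMap_eq_det_smul b,
      alternatingMap_eq_det_smul b _ v, Module.Basis.det_comp, mul_smul]
  | zero => simp
  | add x y _ _ hx hy => rw [map_add, hx, hy, smul_add]
  | smul c x _ hx => rw [map_smul, hx, smul_comm]

end Determinant

/-! ### Bases adapted to `G_H`. -/

section Isotypic

variable {k : Type*} [Field k] [CharZero k] {V : Type*} [AddCommGroup V] [Module k V]
  [FiniteDimensional k V] {G : Subgroup (V ≃ₗ[k] V)} [Finite G]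
  {M : Type*} [AddCommGroup M] [Module k M] [FiniteDimensional k M]

/-- The restriction of `M` to the cyclic group `G_H` is a sum of powers of the determinant. -/
theorem exists_exponentFamily (ρ : Representation k G M) {H : Submodule k V}
    {a : Module.Dual k V} (ha : LinearMap.ker a = H) (hH : H ≠ ⊤) :
    ∃ j : Fin (Module.finrank k M) → ℕ, IsExponentFamily G H ρ j := by
  cases nonempty_fintype (hypStab G H)
  have hspan : ⊤ ≤ Submodule.span k {x | ∃ j < hypOrder G H, x ∈ hypIsotypic G H ρ j} := by
    intro x _
    -- Unnormalized projection onto the component of index `j`. In the sum over `j`, the term of `g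
    -- ≠ 1` is a vanishing geometric sum, because `det g ≠ 1`.
    let P (j : ℕ) : M := ∑ g : hypStab G H, ((detV G (g : G) ^ j : kˣ) : k) • ρ (g : G) x
    have hP (j : ℕ) : P j ∈ hypIsotypic G H ρ j := by
      intro h hh
      rw [map_sum, Finset.smul_sum]
      refine Fintype.sum_equiv (Equiv.mulLeft ⟨h, hh⟩) _ _ fun g => ?_
      rw [map_smul, smul_smul, ← Units.val_mul, Equiv.coe_mulLeft, Subgroup.coe_mul, map_mul,
        mul_pow, ← mul_assoc, inv_pow, inv_mul_cancel, one_mul, map_mul, Module.End.mul_apply]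
    have hsum : ∑ j ∈ Finset.range (hypOrder G H), P j = (hypOrder G H : k) • x := by
      rw [Finset.sum_comm, Finset.sum_eq_single 1]
      · simp [Nat.cast_smul_eq_nsmul]
      · intro g _ hg
        rw [← Finset.sum_smul]
        have hne : (detV G (g : G) : k) ≠ 1 := fun h => hg (by
          apply detV_injOn ha hH
          rw [map_one]
          exact Units.ext h)
        have hpow : (detV G (g : G) : k) ^ hypOrder G H = 1 := by
          have : g ^ hypOrder G H = 1 := pow_card_eq_one'
          have h2 := congrArg (fun y : hypStab G H => (detV G (y : G) : k)) this
          simpa using h2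
        have h3 := geom_sum_mul (detV G (g : G) : k) (hypOrder G H)
        rw [hpow, sub_self, mul_eq_zero, or_iff_left (sub_ne_zero.2 hne)] at h3
        simp_rw [Units.val_pow_eq_pow_val, h3, zero_smul]
      · simp
    have he : (hypOrder G H : k) ≠ 0 := Nat.cast_ne_zero.2 (hypOrder_pos H).ne'
    rw [← inv_smul_smul₀ he x, ← hsum]
    exact Submodule.smul_mem _ _ (sum_mem fun j hj =>
      Submodule.subset_span ⟨j, Finset.mem_range.1 hj, hP j⟩)
  let b := (Module.Basis.ofSpan hspan).reindex
    ((Module.Basis.ofSpan hspan).indexEquiv (Module.finBasis k M))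
  have hb (i) : ∃ j < hypOrder G H, b i ∈ hypIsotypic G H ρ j := by
    refine Module.Basis.ofSpan_subset hspan ?_
    rw [Module.Basis.reindex_apply]
    exact Set.mem_range_self _
  choose j hj hb using hb
  exact ⟨j, hj, b, hb⟩

omit [CharZero k] [FiniteDimensional k V] [Finite G] [FiniteDimensional k M] in
theorem dual_basis_isotypic {n : ℕ} (ρ : Representation k G M) {H : Submodule k V}
    {j : Fin n → ℕ} (b : Module.Basis (Fin n) k M) (hb : ∀ i, b i ∈ hypIsotypic G H ρ (j i))
    {g : G} (hg : g ∈ hypStab G H) (i : Fin n) :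
    ρ.dual g (b.dualBasis i) = ((detV G g ^ j i : kˣ) : k) • b.dualBasis i := by
  refine b.ext fun m => ?_
  rw [Representation.dual_apply, Module.Dual.transpose_apply, LinearMap.comp_apply,
    hb m _ (inv_mem hg), map_inv, inv_inv, map_smul, LinearMap.smul_apply]
  by_cases him : i = m
  · rw [him]
  · simp [him]

end Isotypic

/-! ### Coordinates and generators of `Ω`. -/

section Forms

variable {k : Type*} [Field k] {A : Type*} [CommRing A] [Algebra k A]
  {M : Type*} [AddCommGroup M] [Module k M]

theorem forms_smul_eq_zero [IsDomain A] {c : A} (hc : c ≠ 0) {x : Forms k A M} (h : c • x = 0) :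
    x = 0 :=
  (smul_eq_zero.1 h).resolve_left hc

theorem forms_smul_cancel [IsDomain A] {c : A} (hc : c ≠ 0) {x y : Forms k A M}
    (h : c • x = c • y) : x = y :=
  smul_right_injective _ hc h

/-- Divisibility of forms can be tested on coordinates. -/
theorem exists_smul_eq_of_dvd {Q : A} {x : Forms k A M}
    (h : ∀ i, Q ∣ (Algebra.TensorProduct.basis A
      (Module.Free.chooseBasis k (ExteriorAlgebra k (Module.Dual k M)))).repr x i) :
    ∃ y, Q • y = x := by
  set b := Algebra.TensorProduct.basis A
    (Module.Free.chooseBasis k (ExteriorAlgebra k (Module.Dual k M)))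
  choose c hc using h
  refine ⟨∑ i ∈ (b.repr x).support, c i • b i, ?_⟩
  conv_rhs => rw [← b.linearCombination_repr x, Finsupp.linearCombination_apply, Finsupp.sum]
  rw [Finset.smul_sum]
  exact Finset.sum_congr rfl fun i _ => by rw [smul_smul, ← hc]

theorem dvd_repr_of_smul {ι : Type*} (b : Module.Basis ι A (Forms k A M)) {c : A}
    {x y : Forms k A M} (h : c • y = x) (i : ι) : c ∣ b.repr x i := by
  rw [← h, map_smul, Finsupp.smul_apply, smul_eq_mul]
  exact dvd_mul_right _ _

/-- A product of elements of a family of linear forms on `M`. -/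
def listForm (A : Type*) [CommRing A] [Algebra k A] {ι : Type*} (e : ι → Module.Dual k M)
    (l : List ι) : Forms k A M :=
  1 ⊗ₜ (l.map fun i => ExteriorAlgebra.ι k (e i)).prod

theorem listForm_mul {ι : Type*} (e : ι → Module.Dual k M) (l l' : List ι) :
    listForm A e l * listForm A e l' = listForm A e (l ++ l') := by
  simp [listForm]

theorem listForm_eq_zero {ι : Type*} (e : ι → Module.Dual k M) {l : List ι} (hl : ¬ l.Nodup) :
    listForm A e l = 0 := by
  rw [listForm, prod_map_eq_zero _ _ hl, TensorProduct.tmul_zero]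
  · exact fun i => ExteriorAlgebra.ι_sq_zero _
  · exact fun i j => ι_anticomm _ _

theorem mem_span_listForm {ι : Type*} (e : Module.Basis ι k (Module.Dual k M))
    (x : Forms k A M) :
    x ∈ Submodule.span k {y | ∃ (a : A) (l : List ι), y = a • listForm A e l} := by
  induction x using TensorProduct.induction_on with
  | zero => exact zero_mem _
  | add x y hx hy => exact add_mem hx hy
  | tmul a y =>
    induction span_prod_basis e y using Submodule.span_induction with
    | mem y hy =>
      obtain ⟨l, rfl⟩ := hy
      refine Submodule.subset_span ⟨a, l, ?_⟩
      rw [listForm, TensorProduct.smul_tmul', smul_eq_mul, mul_one]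
    | zero => rw [TensorProduct.tmul_zero]; exact zero_mem _
    | add x y _ _ hx hy => rw [TensorProduct.tmul_add]; exact add_mem hx hy
    | smul c x _ hx => rw [TensorProduct.tmul_smul]; exact Submodule.smul_mem _ _ hx

end Forms

/-! ### Existence of the twisted product. -/

section Action

variable {k : Type*} [Field k] {V : Type*} [AddCommGroup V] [Module k V]
  {G : Subgroup (V ≃ₗ[k] V)} {α : Submodule k V → Module.Dual k V} {B : Set (Submodule k V)}
  (A : Type*) [CommRing A] [Algebra k A] [Algebra (PolyFun k V) A]
  [IsScalarTower k (PolyFun k V) A] [IsLocalization (badMonoid α B) A]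
  {M : Type*} [AddCommGroup M] [Module k M]

variable {A}

theorem formsAct_listForm (hB : IsBadData G α B) (ρ : Representation k G M)
    {H : Submodule k V} {n : ℕ} {j : Fin n → ℕ} (b : Module.Basis (Fin n) k M)
    (hb : ∀ i, b i ∈ hypIsotypic G H ρ (j i)) {g : G} (hg : g ∈ hypStab G H)
    (l : List (Fin n)) :
    formsAct A hB ρ g (listForm A b.dualBasis l) =
      ((detV G g ^ (l.map j).sum : kˣ) : k) • listForm A b.dualBasis l := by
  rw [listForm, formsAct, Algebra.TensorProduct.map_tmul, map_one, ← TensorProduct.tmul_smul]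
  congr 1
  induction l with
  | nil => simp
  | cons i l ih =>
    simp only [List.map_cons, List.prod_cons, List.sum_cons, map_mul, ih,
      ExteriorAlgebra.map_apply_ι, dual_basis_isotypic ρ b hb hg, map_smul, smul_mul_smul_comm,
      pow_add, Units.val_mul]

/-- An element of `Ω^χ` is a combination of products of a basis of `M*` adapted to `G_H`, with
semi-invariant coefficients. -/
theorem mem_span_semiinvariant [CharZero k] [Finite G] (hB : IsBadData G α B)
    (ρ : Representation k G M) (χ : G →* kˣ) {H : Submodule k V} {n : ℕ} {j : Fin n → ℕ}
    (b : Module.Basis (Fin n) k M) (hb : ∀ i, b i ∈ hypIsotypic G H ρ (j i)) {x : Forms k A M}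
    (hx : x ∈ formsChi A hB ρ χ) :
    x ∈ Submodule.span k {y : Forms k A M | ∃ (f : A) (l : List (Fin n)),
      (∀ g ∈ hypStab G H,
        locAct A hB g f = (((χ * ((detV G) ^ (l.map j).sum)⁻¹) g : kˣ) : k) • f) ∧
      y = f • listForm A b.dualBasis l} := by
  cases nonempty_fintype (hypStab G H)
  -- Averaging over `G_H` against `χ⁻¹` multiplies `x` by the order of `G_H`. On `f • listForm` it
  -- averages only the coefficient, against the character `c` introduced below.
  let P : Forms k A M →ₗ[k] Forms k A M :=
    ∑ g : hypStab G H, ((χ (g : G))⁻¹ : kˣ) • (formsAct A hB ρ (g : G)).toLinearMap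
  have hPx : P x = (Fintype.card (hypStab G H) : k) • x := by
    rw [LinearMap.sum_apply]
    have (g : hypStab G H) : (((χ (g : G))⁻¹ : kˣ) • (formsAct A hB ρ (g : G)).toLinearMap) x =
        x := by
      rw [LinearMap.smul_apply, AlgHom.toLinearMap_apply, hx, Units.smul_def, smul_smul,
        Units.inv_mul, one_smul]
    rw [Finset.sum_congr rfl fun g _ => this g, Finset.sum_const, Finset.card_univ,
      Nat.cast_smul_eq_nsmul]
  have hne : (Fintype.card (hypStab G H) : k) ≠ 0 := Nat.cast_ne_zero.2 Fintype.card_ne_zero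
  rw [← inv_smul_smul₀ hne x, ← hPx]
  refine Submodule.smul_mem _ _ ?_
  clear hPx hx
  induction mem_span_listForm b.dualBasis x using Submodule.span_induction with
  | zero => rw [map_zero]; exact zero_mem _
  | add x y _ _ hx hy => rw [map_add]; exact add_mem hx hy
  | smul c x _ hx => rw [map_smul]; exact Submodule.smul_mem _ _ hx
  | mem y hy =>
    obtain ⟨f, l, rfl⟩ := hy
    set c := χ * ((detV G) ^ (l.map j).sum)⁻¹ with hc
    refine Submodule.subset_span
      ⟨∑ g : hypStab G H, ((c (g : G))⁻¹ : kˣ) • locAct A hB (g : G) f, l, fun h hh => ?_, ?_⟩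
    · rw [map_sum, ← Units.smul_def, Finset.smul_sum]
      refine Fintype.sum_equiv (Equiv.mulLeft ⟨h, hh⟩) _ _ fun g => ?_
      rw [Units.smul_def, map_smul, ← Units.smul_def, smul_smul, Equiv.coe_mulLeft,
        Subgroup.coe_mul, map_mul, locAct_mul, mul_inv, mul_inv_cancel_left, AlgHom.comp_apply]
    · rw [LinearMap.sum_apply, Finset.sum_smul]
      refine Finset.sum_congr rfl fun g _ => ?_
      rw [LinearMap.smul_apply, AlgHom.toLinearMap_apply, formsAct_smul,
        formsAct_listForm hB ρ b hb g.2, smul_comm _ (Units.val _), ← Units.smul_def, smul_smul,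
        Units.smul_def, Units.smul_def, smul_assoc]
      congr 3
      rw [hc]
      simp [mul_comm]

/-- Acceptability of `H` makes `μ ∧ ω` divisible by `α_H ^ n_H(χ)`. -/
theorem exists_form_pow_smul_eq_mul [CharZero k] [FiniteDimensional k V] [Finite G]
    [FiniteDimensional k M] (hB : IsBadData G α B)
    (ρ : Representation k G M) (χ : G →* kˣ) {H : Submodule k V} (hH : H ∈ hyperplanes G)
    (hacc : IsAcceptable G H ρ χ) {μ ω : Forms k A M} (hμ : μ ∈ formsChi A hB ρ χ)
    (hω : ω ∈ formsChi A hB ρ χ) :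
    ∃ ν : Forms k A M, algebraMap (PolyFun k V) A (SymmetricAlgebra.ι k _ (α H)) ^
      charWeight G H χ • ν = μ * ω := by
  obtain ⟨j, hj⟩ := exists_exponentFamily ρ (hB.ker_eq H hH) (hyperplane_ne_top hH)
  obtain ⟨b, hb⟩ := hj.2
  set a := algebraMap (PolyFun k V) A (SymmetricAlgebra.ι k _ (α H)) ^ charWeight G H χ with ha
  -- Such an `f` has weight `n_H(χ) + (l.map j).sum`; below `e_H`, this is the power of `α_H` that
  -- divides it.
  have hsemi (f : A) (l : List (Fin (Module.finrank k M)))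
      (hf : ∀ g ∈ hypStab G H,
        locAct A hB g f = (((χ * ((detV G) ^ (l.map j).sum)⁻¹) g : kˣ) : k) • f)
      (hl : (((l.map j).sum : ℕ) : ℤ) < hypOrder G H - charWeight G H χ) : a ∣ f := by
    obtain ⟨-, h2⟩ := charWeight_spec (G := G) (hB.ker_eq H hH) (hyperplane_ne_top hH) χ
    refine (pow_dvd_pow _ (Nat.le_add_right _ (l.map j).sum)).trans
      (form_pow_dvd_of_semiinvariant A hB hH (by omega) fun g hg => ?_)
    rw [hf g hg, pow_add, ← h2 g hg]
    simp
  change μ * ω ∈ LinearMap.range (LinearMap.lsmul A (Forms k A M) a)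
  rw [← Submodule.restrictScalars_mem k]
  have hμ' := mem_span_semiinvariant hB ρ χ b hb hμ
  have hω' := mem_span_semiinvariant hB ρ χ b hb hω
  clear hμ hω
  induction hμ', hω' using Submodule.span_induction₂ with
  | zero_left => rw [zero_mul]; exact zero_mem _
  | zero_right => rw [mul_zero]; exact zero_mem _
  | add_left x y z _ _ _ h h' => rw [add_mul]; exact add_mem h h'
  | add_right x y z _ _ _ h h' => rw [mul_add]; exact add_mem h h'
  | smul_left r x y _ _ h => rw [smul_mul_assoc]; exact Submodule.smul_mem _ _ h
  | smul_right r x y _ _ h => rw [mul_smul_comm]; exact Submodule.smul_mem _ _ h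
  | mem_mem x y hx hy =>
    obtain ⟨f, l, hf, rfl⟩ := hx
    obtain ⟨f', l', hf', rfl⟩ := hy
    rw [smul_mul_smul_comm, listForm_mul, Submodule.restrictScalars_mem]
    -- If the index lists overlap, the product is zero. Otherwise acceptability is applied to the
    -- partition into `l` and its complement, which contains `l'`.
    by_cases hl : (l ++ l').Nodup
    · have hdvd : a ∣ f * f' := by
        obtain ⟨hl1, hl2, hdisj⟩ := List.nodup_append'.1 hl
        rcases hacc j hj l.toFinset l.toFinsetᶜ disjoint_compl_right (by simp) with h | h
        · refine (hsemi f l hf ?_).mul_right _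
          rw [← List.sum_toFinset _ hl1]
          exact_mod_cast h
        · refine (hsemi f' l' hf' (lt_of_le_of_lt ?_ h)).mul_left _
          rw [← List.sum_toFinset _ hl2, Nat.cast_sum]
          refine Finset.sum_le_sum_of_subset_of_nonneg (fun i hi => ?_) fun _ _ _ => by positivity
          rw [Finset.mem_compl, List.mem_toFinset]
          exact fun hi' => hdisj hi' (List.mem_toFinset.1 hi)
      obtain ⟨c, hc⟩ := hdvd
      exact ⟨c • listForm A b.dualBasis (l ++ l'), by
        rw [LinearMap.lsmul_apply, smul_smul, hc]⟩
    · rw [listForm_eq_zero _ hl, smul_zero]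
      exact zero_mem _

/-- Coordinate by coordinate and hyperplane by hyperplane: `α_H` is a unit for `H` in `B`, and
acceptability handles the others. -/
theorem exists_Qloc_smul_eq_mul [CharZero k] [FiniteDimensional k V] [Finite G]
    [FiniteDimensional k M] (hB : IsBadData G α B)
    (ρ : Representation k G M) (χ : G →* kˣ)
    (hacc : ∀ H ∈ hyperplanes G \ B, IsAcceptable G H ρ χ) {μ ω : Forms k A M}
    (hμ : μ ∈ formsChi A hB ρ χ) (hω : ω ∈ formsChi A hB ρ χ) :
    ∃ ν : Forms k A M, Qloc α A χ • ν = μ * ω := by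
  refine exists_smul_eq_of_dvd fun i => Qloc_dvd A hB χ fun H hH => ?_
  by_cases hHB : H ∈ B
  · have : IsUnit (algebraMap (PolyFun k V) A (SymmetricAlgebra.ι k _ (α H))) :=
      IsLocalization.map_units A
        (⟨_, Submonoid.subset_closure ⟨_, hHB, rfl⟩⟩ : badMonoid α B)
    exact (this.pow _).dvd
  · obtain ⟨ν, hν⟩ := exists_form_pow_smul_eq_mul hB ρ χ hH (hacc H ⟨hH, hHB⟩) hμ hω
    exact dvd_repr_of_smul _ hν i

theorem Qloc_smul_eq_mul_iff [CharZero k] [FiniteDimensional k V] [Finite G]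
    [FiniteDimensional k M] (hB : IsBadData G α B)
    (ρ : Representation k G M) (χ : G →* kˣ)
    (hacc : ∀ H ∈ hyperplanes G \ B, IsAcceptable G H ρ χ) {μ ω : Forms k A M}
    (hμ : μ ∈ formsChi A hB ρ χ) (hω : ω ∈ formsChi A hB ρ χ) (ν : Forms k A M) :
    Qloc α A χ • ν = μ * ω ↔ ν = twistedMul α χ μ ω := by
  have := isDomain_loc A hB
  have h := exists_Qloc_smul_eq_mul hB ρ χ hacc hμ hω
  rw [twistedMul, dif_pos h]
  constructor
  · intro h1
    exact forms_smul_cancel (Qloc_ne_zero A hB χ) (h1.trans h.choose_spec.symm)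
  · rintro rfl
    exact h.choose_spec

theorem twistedMul_mem [CharZero k] [FiniteDimensional k V] [Finite G]
    (hG : Subgroup.closure {s : V ≃ₗ[k] V | s ∈ G ∧ IsReflection s} = G)
    [FiniteDimensional k M] (hB : IsBadData G α B)
    (ρ : Representation k G M) (χ : G →* kˣ)
    (hacc : ∀ H ∈ hyperplanes G \ B, IsAcceptable G H ρ χ) {μ ω : Forms k A M}
    (hμ : μ ∈ formsChi A hB ρ χ) (hω : ω ∈ formsChi A hB ρ χ) :
    twistedMul α χ μ ω ∈ formsChi A hB ρ χ := by
  have := isDomain_loc A hB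
  intro g
  have h1 := (Qloc_smul_eq_mul_iff hB ρ χ hacc hμ hω _).2 rfl
  -- Applying `g` to `Q_χ ν = μ ω` gives `χ(g)` on `Q_χ` and `χ(g)²` on the right; cancelling leaves
  -- `g ν = χ(g) ν`.
  have h2 := congrArg (formsAct A hB ρ g) h1
  rw [formsAct_smul, map_mul, hμ g, hω g, smul_mul_smul_comm, ← h1, locAct_Qloc A hG, mul_smul,
    smul_assoc] at h2
  have h3 := smul_right_injective _ (Units.ne_zero (χ g)) h2
  rw [smul_comm] at h3
  exact forms_smul_cancel (Qloc_ne_zero A hB χ) h3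

end Action

/-! ### The grading of `Ω`. -/

section Degree

variable {k : Type*} [Field k] {A : Type*} [CommRing A] [Algebra k A]
  {M : Type*} [AddCommGroup M] [Module k M]

theorem formsDeg_eq_span (p : ℕ) : formsDeg k A M p =
    Submodule.span A ((fun y => (1 : A) ⊗ₜ[k] y) '' (⋀[k]^p (Module.Dual k M) :
      Submodule k (ExteriorAlgebra k (Module.Dual k M)))) :=
  Submodule.baseChange_eq_span ..

theorem mul_mem_formsDeg {p q : ℕ} {x y : Forms k A M} (hx : x ∈ formsDeg k A M p)
    (hy : y ∈ formsDeg k A M q) : x * y ∈ formsDeg k A M (p + q) := by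
  rw [formsDeg_eq_span] at hx hy
  induction hx, hy using Submodule.span_induction₂ with
  | zero_left => rw [zero_mul]; exact zero_mem _
  | zero_right => rw [mul_zero]; exact zero_mem _
  | add_left x y z _ _ _ h h' => rw [add_mul]; exact add_mem h h'
  | add_right x y z _ _ _ h h' => rw [mul_add]; exact add_mem h h'
  | smul_left r x y _ _ h => rw [smul_mul_assoc]; exact Submodule.smul_mem _ _ h
  | smul_right r x y _ _ h => rw [mul_smul_comm]; exact Submodule.smul_mem _ _ h
  | mem_mem x y hx hy =>
    obtain ⟨x, hx, rfl⟩ := hx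
    obtain ⟨y, hy, rfl⟩ := hy
    rw [formsDeg_eq_span]
    refine Submodule.subset_span ⟨x * y, ?_, by simp⟩
    rw [SetLike.mem_coe, ExteriorAlgebra.exteriorPower, pow_add]
    exact Submodule.mul_mem_mul hx hy

/-- `Ω^p` is the image of an `A`-linear projection `P`; from `c • P x = P (c • x) = c • x`,
torsion-freeness gives `P x = x`. -/
theorem mem_formsDeg_of_smul_mem [IsDomain A] {p : ℕ} {c : A} (hc : c ≠ 0) {x : Forms k A M}
    (h : c • x ∈ formsDeg k A M p) : x ∈ formsDeg k A M p := by
  obtain ⟨π, hπ⟩ := Submodule.exists_isCompl (⋀[k]^p (Module.Dual k M))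
  let P : Forms k A M →ₗ[A] Forms k A M := (Submodule.subtype _ ∘ₗ
    Submodule.projectionOnto (⋀[k]^p (Module.Dual k M)) π hπ).baseChange A
  have hP (y : Forms k A M) : P y ∈ formsDeg k A M p := by
    induction y using TensorProduct.induction_on with
    | zero => rw [map_zero]; exact zero_mem _
    | add x y hx hy => rw [map_add]; exact add_mem hx hy
    | tmul a y => exact Submodule.tmul_mem_baseChange_of_mem a (Subtype.property _)
  have hP' {y : Forms k A M} (hy : y ∈ formsDeg k A M p) : P y = y := by
    rw [formsDeg_eq_span] at hy
    induction hy using Submodule.span_induction with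
    | zero => rw [map_zero]
    | add x y _ _ hx hy => rw [map_add, hx, hy]
    | smul a y _ hy => rw [map_smul, hy]
    | mem y hy =>
      obtain ⟨y, hy, rfl⟩ := hy
      rw [LinearMap.baseChange_tmul, LinearMap.comp_apply,
        Submodule.projectionOnto_apply_left hπ ⟨y, hy⟩]
      rfl
  have h1 := hP' h
  rw [map_smul] at h1
  rw [← forms_smul_cancel hc h1]
  exact hP x

theorem formsDeg_one_anticomm {x y : Forms k A M} (hx : x ∈ formsDeg k A M 1)
    (hy : y ∈ formsDeg k A M 1) : x * y = -(y * x) := by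
  rw [formsDeg_eq_span] at hx hy
  induction hx, hy using Submodule.span_induction₂ with
  | zero_left => simp
  | zero_right => simp
  | add_left x y z _ _ _ h h' => rw [add_mul, mul_add, h, h', neg_add]
  | add_right x y z _ _ _ h h' => rw [mul_add, add_mul, h, h', neg_add]
  | smul_left r x y _ _ h => rw [smul_mul_assoc, mul_smul_comm, h, smul_neg]
  | smul_right r x y _ _ h => rw [mul_smul_comm, smul_mul_assoc, h, smul_neg]
  | mem_mem x y hx hy =>
    obtain ⟨x, hx, rfl⟩ := hx
    obtain ⟨y, hy, rfl⟩ := hy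
    rw [SetLike.mem_coe, ExteriorAlgebra.exteriorPower, pow_one] at hx hy
    obtain ⟨x, rfl⟩ := hx
    obtain ⟨y, rfl⟩ := hy
    simp only [Algebra.TensorProduct.tmul_mul_tmul, ι_anticomm x y, TensorProduct.tmul_neg]

theorem formsDeg_one_sq [CharZero k] {x : Forms k A M} (hx : x ∈ formsDeg k A M 1) :
    x * x = 0 := by
  have h := formsDeg_one_anticomm hx hx
  rw [eq_neg_iff_add_eq_zero, ← two_smul k] at h
  exact (smul_eq_zero.1 h).resolve_left two_ne_zero

theorem prod_mem_formsDeg {ι : Type*} {ω : ι → Forms k A M} (hω : ∀ i, ω i ∈ formsDeg k A M 1)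
    (l : List ι) : (l.map ω).prod ∈ formsDeg k A M l.length := by
  induction l with
  | nil =>
    refine Submodule.tmul_mem_baseChange_of_mem (1 : A) ?_
    rw [List.length_nil, ExteriorAlgebra.exteriorPower, pow_zero]
    exact Submodule.one_le.1 le_rfl
  | cons i l ih =>
    rw [List.map_cons, List.prod_cons, List.length_cons, add_comm]
    exact mul_mem_formsDeg (hω i) ih

theorem mem_formsDeg_top {r : ℕ} [FiniteDimensional k M] (hr : Module.finrank k M = r)
    {vol : ExteriorAlgebra k (Module.Dual k M)} (hvol : vol ∈ ⋀[k]^r (Module.Dual k M))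
    (hvol0 : vol ≠ 0) {x : Forms k A M} (hx : x ∈ formsDeg k A M r) :
    ∃ f : A, x = f ⊗ₜ[k] vol := by
  have h1 : Module.finrank k (⋀[k]^r (Module.Dual k M)) = 1 := by
    rw [exteriorPower.finrank_eq, Subspace.dual_finrank_eq, hr, Nat.choose_self]
  rw [formsDeg_eq_span] at hx
  induction hx using Submodule.span_induction with
  | zero => exact ⟨0, (TensorProduct.zero_tmul _ _).symm⟩
  | add x y _ _ hx hy =>
    obtain ⟨f, rfl⟩ := hx
    obtain ⟨f', rfl⟩ := hy
    exact ⟨f + f', (TensorProduct.add_tmul _ _ _).symm⟩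
  | smul c x _ hx =>
    obtain ⟨f, rfl⟩ := hx
    exact ⟨c * f, by rw [TensorProduct.smul_tmul', smul_eq_mul]⟩
  | mem x hx =>
    obtain ⟨y, hy, rfl⟩ := hx
    obtain ⟨c, hc⟩ := (finrank_eq_one_iff_of_nonzero'
      (⟨vol, hvol⟩ : ⋀[k]^r (Module.Dual k M)) (fun h => hvol0 (congrArg Subtype.val h))).1 h1
      ⟨y, hy⟩
    refine ⟨c • 1, ?_⟩
    rw [TensorProduct.smul_tmul]
    exact congrArg (fun y => (1 : A) ⊗ₜ[k] y) (congrArg Subtype.val hc).symm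

theorem tmul_eq_zero_iff [IsDomain A] {f : A} {y : ExteriorAlgebra k (Module.Dual k M)}
    (hy : y ≠ 0) : f ⊗ₜ[k] y = 0 ↔ f = 0 := by
  refine ⟨fun h => ?_, fun h => by rw [h, TensorProduct.zero_tmul]⟩
  by_contra hf
  have h1 : f • ((1 : A) ⊗ₜ[k] y) = 0 := by
    rwa [TensorProduct.smul_tmul', smul_eq_mul, mul_one]
  have h2 := forms_smul_eq_zero hf h1
  have : Function.Injective (Algebra.TensorProduct.includeRight :
      ExteriorAlgebra k (Module.Dual k M) →ₐ[k] Forms k A M) :=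
    Algebra.TensorProduct.includeRight_injective (algebraMap k A).injective
  exact hy (this (h2.trans (map_zero _).symm))

theorem tmul_right_cancel [IsDomain A] {f f' : A} {y : ExteriorAlgebra k (Module.Dual k M)}
    (hy : y ≠ 0) (h : f ⊗ₜ[k] y = f' ⊗ₜ[k] y) : f = f' := by
  rw [← sub_eq_zero, ← TensorProduct.sub_tmul, tmul_eq_zero_iff hy] at h
  exact sub_eq_zero.1 h

end Degree

/-! ### Spanning after clearing denominators. -/

section Span

variable {k : Type*} [Field k] [CharZero k] {A : Type*} [CommRing A] [Algebra k A] [IsDomain A]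
  {M : Type*} [AddCommGroup M] [Module k M] [FiniteDimensional k M]

/-- If the product of `r` forms of degree `1` is nonzero, then these forms span all forms of
degree `1` up to a denominator. -/
theorem exists_smul_mem_span {r : ℕ} (hr : Module.finrank k M = r) {ω : Fin r → Forms k A M}
    (hω : ∀ i, ω i ∈ formsDeg k A M 1) (h0 : ((List.finRange r).map ω).prod ≠ 0) :
    ∃ d : A, d ≠ 0 ∧ ∀ m : Module.Dual k M,
      d • ((1 : A) ⊗ₜ[k] ExteriorAlgebra.ι k m) ∈ Submodule.span A (Set.range ω) := by
  let e : Module.Basis (Fin r) k (Module.Dual k M) :=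
    Module.finBasisOfFinrankEq _ _ (Subspace.dual_finrank_eq.trans hr)
  let ε (j : Fin r) : Forms k A M := 1 ⊗ₜ ExteriorAlgebra.ι k (e j)
  have hε (m : Module.Dual k M) : (1 : A) ⊗ₜ[k] ExteriorAlgebra.ι k m ∈
      Submodule.span A (Set.range ε) := by
    induction e.mem_span m using Submodule.span_induction with
    | zero => rw [map_zero, TensorProduct.tmul_zero]; exact zero_mem _
    | add x y _ _ hx hy => rw [map_add, TensorProduct.tmul_add]; exact add_mem hx hy
    | smul c x _ hx =>
      rw [map_smul, TensorProduct.tmul_smul, ← algebraMap_smul A c]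
      exact Submodule.smul_mem _ _ hx
    | mem x hx =>
      obtain ⟨i, rfl⟩ := hx
      exact Submodule.subset_span ⟨i, rfl⟩
  have hωε (i : Fin r) : ∃ c : Fin r → A, ∑ j, c j • ε j = ω i := by
    rw [← Submodule.mem_span_range_iff_exists_fun]
    have := hω i
    rw [formsDeg_eq_span] at this
    refine Submodule.span_le.2 ?_ this
    rintro _ ⟨y, hy, rfl⟩
    rw [SetLike.mem_coe, ExteriorAlgebra.exteriorPower, pow_one] at hy
    obtain ⟨m, rfl⟩ := hy
    exact hε m
  choose W hW using hωε
  -- A vanishing determinant gives a relation `∑ v i • ω i = 0` with `v i₀ ≠ 0`. Multiplying it by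
  -- all the `ω i` with `i ≠ i₀` leaves only the full product, which would be zero.
  have hdet : (Matrix.of W).det ≠ 0 := by
    intro hdet
    obtain ⟨v, hv, hvW⟩ := Matrix.exists_vecMul_eq_zero_iff.2 hdet
    obtain ⟨i₀, hi₀⟩ := Function.ne_iff.1 hv
    have h1 : ∑ i, v i • ω i = 0 := by
      simp_rw [← hW, Finset.smul_sum, smul_smul]
      rw [Finset.sum_comm]
      refine Finset.sum_eq_zero fun j _ => ?_
      rw [← Finset.sum_smul]
      have := congrFun hvW j
      rw [Matrix.vecMul, dotProduct] at this
      simp only [Matrix.of_apply, Pi.zero_apply] at this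
      rw [this, zero_smul]
    have h2 := congrArg (· * (((List.finRange r).erase i₀).map ω).prod) h1
    simp only [Finset.sum_mul, zero_mul, smul_mul_assoc] at h2
    have hanti (i j) := formsDeg_one_anticomm (hω i) (hω j)
    rw [Finset.sum_eq_single i₀] at h2
    · have h3 := forms_smul_eq_zero hi₀ h2
      rw [← List.prod_cons, ← List.map_cons] at h3
      have h4 := prod_map_perm hanti (List.perm_cons_erase (List.mem_finRange i₀))
      rw [h3, neg_zero, or_self] at h4
      exact h0 h4
    · intro i _ hi
      rw [← List.prod_cons, ← List.map_cons,
        prod_map_eq_zero (fun i => formsDeg_one_sq (hω i)) hanti, smul_zero]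
      rw [List.nodup_cons, not_and_or, not_not]
      exact Or.inl ((List.mem_erase_of_ne hi).2 (List.mem_finRange i))
    · simp
  refine ⟨_, hdet, fun m => ?_⟩
  -- Cramer's rule, through the adjugate matrix.
  have key (j : Fin r) : (Matrix.of W).det • ε j ∈ Submodule.span A (Set.range ω) := by
    have h1 : (Matrix.of W).det • ε j = ∑ i, (Matrix.of W).adjugate j i • ω i := by
      simp_rw [← hW, Finset.smul_sum, smul_smul]
      rw [Finset.sum_comm]
      simp_rw [← Finset.sum_smul]
      have h2 (l : Fin r) : ∑ i, (Matrix.of W).adjugate j i * W i l =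
          ((Matrix.of W).det • (1 : Matrix (Fin r) (Fin r) A)) j l := by
        rw [← Matrix.adjugate_mul, Matrix.mul_apply]
        rfl
      simp_rw [h2]
      simp [Matrix.one_apply]
    rw [h1]
    exact sum_mem fun i _ => Submodule.smul_mem _ _ (Submodule.subset_span ⟨i, rfl⟩)
  have hm := hε m
  generalize (1 : A) ⊗ₜ[k] ExteriorAlgebra.ι k m = x at hm
  induction hm using Submodule.span_induction with
  | zero => rw [smul_zero]; exact zero_mem _
  | add x y _ _ hx hy => rw [smul_add]; exact add_mem hx hy
  | smul c x _ hx => rw [smul_comm]; exact Submodule.smul_mem _ _ hx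
  | mem x hx =>
    obtain ⟨j, rfl⟩ := hx
    exact key j

-- A form of degree `p` is a combination of products of `p` linear forms, and each of these needs
-- one factor `d`.
omit [CharZero k] [IsDomain A] [FiniteDimensional k M] in
theorem pow_smul_mem_span {ι : Type*} {ω : ι → Forms k A M} {d : A}
    (hd : ∀ m : Module.Dual k M,
      d • ((1 : A) ⊗ₜ[k] ExteriorAlgebra.ι k m) ∈ Submodule.span A (Set.range ω))
    {p : ℕ} {x : Forms k A M} (hx : x ∈ formsDeg k A M p) :
    d ^ p • x ∈ Submodule.span A {y | ∃ l : List ι, l.length = p ∧ y = (l.map ω).prod} := by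
  rw [formsDeg_eq_span] at hx
  induction hx using Submodule.span_induction with
  | zero => rw [smul_zero]; exact zero_mem _
  | add x y _ _ hx hy => rw [smul_add]; exact add_mem hx hy
  | smul c x _ hx => rw [smul_comm]; exact Submodule.smul_mem _ _ hx
  | mem x hx =>
    obtain ⟨y, hy, rfl⟩ := hx
    rw [SetLike.mem_coe, ExteriorAlgebra.exteriorPower] at hy
    dsimp only
    induction p generalizing y with
    | zero =>
      rw [pow_zero, Submodule.mem_one] at hy
      obtain ⟨c, rfl⟩ := hy
      rw [Algebra.algebraMap_eq_smul_one, TensorProduct.tmul_smul, ← algebraMap_smul A c]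
      refine Submodule.smul_mem _ _ (Submodule.smul_mem _ _ (Submodule.subset_span ⟨[], rfl, ?_⟩))
      rfl
    | succ p ih =>
      rw [pow_succ'] at hy
      induction hy using Submodule.mul_induction_on' with
      | add x _ y _ hx hy => rw [TensorProduct.tmul_add, smul_add]; exact add_mem hx hy
      | mem_mul_mem m hm n hn =>
        obtain ⟨m, rfl⟩ := hm
        have h := Submodule.mul_mem_mul (hd m) (ih n hn)
        rw [Submodule.span_mul_span, smul_mul_smul_comm, ← pow_succ',
          Algebra.TensorProduct.tmul_mul_tmul, one_mul] at h
        refine Submodule.span_mono ?_ h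
        rintro _ ⟨_, ⟨i, rfl⟩, _, ⟨l, hl, rfl⟩, rfl⟩
        exact ⟨i :: l, by simp [hl], by simp⟩

end Span

/-! ### Increasing index sequences and their complements. -/

section Embeddings

variable {p r : ℕ}

/-- The increasing list of the elements that are not in the image of `I`. -/
def complList (I : Fin p ↪o Fin r) : List (Fin r) :=
  (List.finRange r).filter (· ∉ List.ofFn I)

theorem perm_append_complList (I : Fin p ↪o Fin r) :
    (List.ofFn I ++ complList I).Perm (List.finRange r) := by
  refine (List.perm_ext_iff_of_nodup ?_ (List.nodup_finRange r)).2 fun i => ?_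
  · refine List.nodup_append'.2 ⟨List.nodup_ofFn.2 I.injective,
      (List.nodup_finRange r).filter _, fun i hi hi' => ?_⟩
    simp only [complList, List.mem_filter, decide_eq_true_eq] at hi'
    exact hi'.2 hi
  · simp only [complList, List.mem_append, List.mem_filter, List.mem_finRange, true_and,
      decide_eq_true_eq, iff_true]
    exact em _

theorem add_length_complList (I : Fin p ↪o Fin r) : p + (complList I).length = r := by
  have := (perm_append_complList I).length_eq
  simpa using this

/-- A sequence `J` disjoint from the complement of `I` has its image inside that of `I`; both have
`p` elements, so `J = I`. -/
theorem not_nodup_append_complList {I J : Fin p ↪o Fin r} (h : J ≠ I) :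
    ¬ (List.ofFn J ++ complList I).Nodup := by
  intro hn
  have hd := (List.nodup_append'.1 hn).2.2
  apply h
  have hsub : Finset.univ.image J ⊆ Finset.univ.image I := by
    intro i hi
    by_contra hi'
    have h1 : i ∈ List.ofFn J := by
      rw [List.mem_ofFn]
      simpa using hi
    refine hd h1 ?_
    simp only [complList, List.mem_filter, List.mem_finRange, true_and, decide_eq_true_eq,
      List.mem_ofFn]
    simpa using hi'
  have heq := Finset.eq_of_subset_of_card_le hsub (by
    rw [Finset.card_image_of_injective _ I.injective, Finset.card_image_of_injective _ J.injective])
  have : (J : Fin p → Fin r) = I := by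
    refine (StrictMono.range_inj J.strictMono I.strictMono).1 ?_
    have := congrArg (fun s : Finset (Fin r) => (s : Set (Fin r))) heq
    simpa using this
  exact DFunLike.coe_injective this

theorem exists_perm_ofFn {l : List (Fin r)} (hl : l.Nodup) (hp : l.length = p) :
    ∃ I : Fin p ↪o Fin r, l.Perm (List.ofFn I) := by
  have hc : l.toFinset.card = p := by rw [List.toFinset_card_of_nodup hl, hp]
  refine ⟨l.toFinset.orderEmbOfFin hc, ?_⟩
  refine (List.perm_ext_iff_of_nodup hl (List.nodup_ofFn.2 (l.toFinset.orderEmbOfFin hc).injective)).2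
    fun i => ?_
  rw [List.mem_ofFn, ← Set.mem_range, Finset.range_orderEmbOfFin]
  simp

end Embeddings

theorem locInvariants_smul {k : Type*} [Field k] {V : Type*} [AddCommGroup V] [Module k V]
    {G : Subgroup (V ≃ₗ[k] V)} {α : Submodule k V → Module.Dual k V} {B : Set (Submodule k V)}
    {A : Type*} [CommRing A] [Algebra k A] [Algebra (PolyFun k V) A]
    [IsLocalization (badMonoid α B) A] {M : Type*} [AddCommGroup M] [Module k M]
    (c : locInvariants G α B A) (x : Forms k A M) : c • x = (c : A) • x := rfl

/-! ### Twisted products and the basis criterion. -/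

section Twisted

variable {k : Type*} [Field k] [CharZero k] {V : Type*} [AddCommGroup V] [Module k V]
  [FiniteDimensional k V] {G : Subgroup (V ≃ₗ[k] V)} [Finite G]
  {α : Submodule k V → Module.Dual k V} {B : Set (Submodule k V)}
  {A : Type*} [CommRing A] [Algebra k A] [Algebra (PolyFun k V) A]
  [IsScalarTower k (PolyFun k V) A] [IsLocalization (badMonoid α B) A]
  {M : Type*} [AddCommGroup M] [Module k M]
  (hG : Subgroup.closure {s : V ≃ₗ[k] V | s ∈ G ∧ IsReflection s} = G)
  (hB : IsBadData G α B) (ρ : Representation k G M) (χ : G →* kˣ)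

section Top

include hG

theorem Qloc_tmul_one_mem : Qloc α A χ ⊗ₜ[k] 1 ∈ formsChi A hB ρ χ := by
  intro g
  rw [formsAct, Algebra.TensorProduct.map_tmul, map_one, locAct_Qloc A hG,
    TensorProduct.smul_tmul']

variable [FiniteDimensional k M] {r : ℕ} (hr : Module.finrank k M = r)
  {vol : ExteriorAlgebra k (Module.Dual k M)}
  (hvol : vol ∈ ⋀[k]^r (Module.Dual k M)) (hvol0 : vol ≠ 0)

-- The action on `M*` is contragredient, so `vol` has character `det_M⁻¹`. Its coefficient in a form
-- of character `χ` must therefore have character `χ det_M`.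
omit [CharZero k] [FiniteDimensional k V] [Finite G] hG in
include hr hvol in
theorem formsAct_tmul_vol (g : G) (f : A) :
    formsAct A hB ρ g (f ⊗ₜ[k] vol) =
      (((detRep ρ g)⁻¹ : kˣ) : k) • (locAct A hB g f ⊗ₜ[k] vol) := by
  let e : Module.Basis (Fin r) k (Module.Dual k M) :=
    Module.finBasisOfFinrankEq _ _ (Subspace.dual_finrank_eq.trans hr)
  have hdet : LinearMap.det (ρ.dual g) = (((detRep ρ g)⁻¹ : kˣ) : k) := by
    rw [← map_inv]
    exact LinearMap.det_dualMap (ρ g⁻¹)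
  rw [formsAct, Algebra.TensorProduct.map_tmul, map_eq_det_smul e _ hvol, hdet,
    TensorProduct.tmul_smul]

include hr hvol in
theorem Qloc_tmul_vol_mem : Qloc α A (χ * detRep ρ) ⊗ₜ[k] vol ∈ formsChiDeg A hB ρ χ r := by
  refine ⟨fun g => ?_, Submodule.tmul_mem_baseChange_of_mem _ hvol⟩
  rw [formsAct_tmul_vol hB ρ hr hvol, locAct_Qloc A hG, ← TensorProduct.smul_tmul', smul_smul,
    MonoidHom.mul_apply, Units.val_mul, mul_left_comm, Units.inv_mul, mul_one]

include hr hvol hvol0 in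
/-- The top degree part of `Ω^χ` is generated by `Q_{χ det_M} vol`. -/
theorem exists_smul_vol {x : Forms k A M} (hx : x ∈ formsChiDeg A hB ρ χ r) :
    ∃ c : locInvariants G α B A, x = c • (Qloc α A (χ * detRep ρ) ⊗ₜ[k] vol) := by
  have := isDomain_loc A hB
  obtain ⟨f, rfl⟩ := mem_formsDeg_top hr hvol hvol0 hx.2
  obtain ⟨c, hc, rfl⟩ := exists_eq_mul_Qloc A hG hB (χ * detRep ρ) (x := f) fun g => by
    have h1 := hx.1 g
    rw [formsAct_tmul_vol hB ρ hr hvol, TensorProduct.smul_tmul', TensorProduct.smul_tmul'] at h1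
    have h2 := tmul_right_cancel hvol0 h1
    rw [MonoidHom.mul_apply, mul_comm, Units.val_mul, mul_smul, ← h2, smul_smul, Units.mul_inv,
      one_smul]
  exact ⟨⟨c, hc⟩, rfl⟩

end Top

variable [FiniteDimensional k M] (hacc : ∀ H ∈ hyperplanes G \ B, IsAcceptable G H ρ χ)

section Lists

variable {ι : Type*} {ω : ι → Forms k A M} (hω : ∀ i, ω i ∈ formsChiDeg A hB ρ χ 1)

include hG hacc hω

theorem twistedProd_mem (l : List ι) : twistedProd α χ (l.map ω) ∈ formsChi A hB ρ χ := by
  induction l with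
  | nil => exact Qloc_tmul_one_mem hG hB ρ χ
  | cons i l ih => exact twistedMul_mem hG hB ρ χ hacc (hω i).1 ih

theorem Qloc_smul_twistedProd_cons (i : ι) (l : List ι) :
    Qloc α A χ • twistedProd α χ ((i :: l).map ω) = ω i * twistedProd α χ (l.map ω) :=
  (Qloc_smul_eq_mul_iff hB ρ χ hacc (hω i).1
    (twistedProd_mem hG hB ρ χ hacc hω l) _).2 rfl

/-- The bridge to ordinary exterior products. The factor `Q_χ` on the right lets the identity
include the empty list, whose twisted product is `Q_χ`. -/
theorem Qloc_pow_smul_twistedProd (l : List ι) :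
    Qloc α A χ ^ l.length • twistedProd α χ (l.map ω) = Qloc α A χ • (l.map ω).prod := by
  induction l with
  | nil =>
    rw [List.length_nil, pow_zero, one_smul]
    change _ = Qloc α A χ • ((1 : A) ⊗ₜ[k] 1)
    rw [TensorProduct.smul_tmul', smul_eq_mul, mul_one]
    rfl
  | cons i l ih =>
    rw [List.length_cons, pow_succ, mul_smul, Qloc_smul_twistedProd_cons hG hB ρ χ hacc hω,
      ← mul_smul_comm, ih, mul_smul_comm, List.map_cons, List.prod_cons]

theorem twistedProd_mem_deg (l : List ι) :
    twistedProd α χ (l.map ω) ∈ formsChiDeg A hB ρ χ l.length := by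
  have := isDomain_loc A hB
  refine ⟨twistedProd_mem hG hB ρ χ hacc hω l,
    mem_formsDeg_of_smul_mem (pow_ne_zero l.length (Qloc_ne_zero A hB χ)) ?_⟩
  rw [Qloc_pow_smul_twistedProd hG hB ρ χ hacc hω]
  exact Submodule.smul_mem _ _ (prod_mem_formsDeg (fun i => (hω i).2) l)

theorem twistedProd_mul (l l' : List ι) :
    twistedProd α χ (l.map ω) * twistedProd α χ (l'.map ω) =
      Qloc α A χ • twistedProd α χ ((l ++ l').map ω) := by
  have := isDomain_loc A hB
  refine forms_smul_cancel (pow_ne_zero (l ++ l').length (Qloc_ne_zero A hB χ)) ?_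
  rw [smul_comm, Qloc_pow_smul_twistedProd hG hB ρ χ hacc hω, List.length_append, pow_add,
    ← smul_mul_smul_comm, Qloc_pow_smul_twistedProd hG hB ρ χ hacc hω,
    Qloc_pow_smul_twistedProd hG hB ρ χ hacc hω, smul_mul_smul_comm, List.map_append,
    List.prod_append, mul_smul]

theorem twistedProd_perm {l l' : List ι} (h : l.Perm l') :
    twistedProd α χ (l.map ω) = twistedProd α χ (l'.map ω) ∨
      twistedProd α χ (l.map ω) = -twistedProd α χ (l'.map ω) := by
  have := isDomain_loc A hB
  have hQ := pow_ne_zero l'.length (Qloc_ne_zero A hB χ)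
  have e := Qloc_pow_smul_twistedProd hG hB ρ χ hacc hω l
  have e' := Qloc_pow_smul_twistedProd hG hB ρ χ hacc hω l'
  rw [h.length_eq] at e
  rcases prod_map_perm (fun i j => formsDeg_one_anticomm (hω i).2 (hω j).2) h with h | h
  · left
    exact forms_smul_cancel hQ (by rw [e, e', h])
  · right
    exact forms_smul_cancel hQ (by rw [smul_neg, e, e', h, smul_neg])

theorem twistedProd_eq_zero {l : List ι} (h : ¬ l.Nodup) : twistedProd α χ (l.map ω) = 0 := by
  have := isDomain_loc A hB
  refine forms_smul_eq_zero (pow_ne_zero l.length (Qloc_ne_zero A hB χ)) ?_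
  rw [Qloc_pow_smul_twistedProd hG hB ρ χ hacc hω, prod_map_eq_zero
    (fun i => formsDeg_one_sq (hω i).2) (fun i j => formsDeg_one_anticomm (hω i).2 (hω j).2) h,
    smul_zero]

end Lists

section Basis

variable {r : ℕ} {ω : Fin r → Forms k A M} (hω : ∀ i, ω i ∈ formsChiDeg A hB ρ χ 1) {p : ℕ}

include hG hacc hω

theorem twistedProd_mul_compl (I : Fin p ↪o Fin r) :
    ∃ ε : A, ε * ε = 1 ∧ ε ∈ locInvariants G α B A ∧
      twistedProd α χ ((List.ofFn I).map ω) * twistedProd α χ ((complList I).map ω) =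
        (ε * Qloc α A χ) • twistedProd α χ ((List.finRange r).map ω) := by
  rw [twistedProd_mul hG hB ρ χ hacc hω]
  rcases twistedProd_perm hG hB ρ χ hacc hω (perm_append_complList I) with h | h
  · exact ⟨1, one_mul 1, one_mem _, by rw [h, one_mul]⟩
  · exact ⟨-1, by ring, neg_mem (one_mem _), by rw [h, smul_neg, neg_one_mul, neg_smul]⟩

theorem twistedProd_mul_compl_of_ne {I J : Fin p ↪o Fin r} (h : J ≠ I) :
    twistedProd α χ ((List.ofFn J).map ω) * twistedProd α χ ((complList I).map ω) = 0 := by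
  rw [twistedProd_mul hG hB ρ χ hacc hω,
    twistedProd_eq_zero hG hB ρ χ hacc hω (not_nodup_append_complList h), smul_zero]

/-- Coefficient extraction: the products indexed by `J ≠ I` meet the complement of `I` in a repeated
factor and vanish. `ε` is the sign of the reordering. -/
theorem sum_smul_mul_compl [Fintype (Fin p ↪o Fin r)] (I : Fin p ↪o Fin r) :
    ∃ ε : A, ε * ε = 1 ∧ ε ∈ locInvariants G α B A ∧ ∀ c : (Fin p ↪o Fin r) → A,
      (∑ J, c J • twistedProd α χ ((List.ofFn J).map ω)) *
        twistedProd α χ ((complList I).map ω) =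
        (c I * (ε * Qloc α A χ)) • twistedProd α χ ((List.finRange r).map ω) := by
  obtain ⟨ε, h1, h2, h3⟩ := twistedProd_mul_compl hG hB ρ χ hacc hω I
  refine ⟨ε, h1, h2, fun c => ?_⟩
  rw [Finset.sum_mul, Finset.sum_eq_single I, smul_mul_assoc, h3, smul_smul]
  · intro J _ hJ
    rw [smul_mul_assoc, twistedProd_mul_compl_of_ne hG hB ρ χ hacc hω hJ, smul_zero]
  · simp

theorem linearIndependent_twistedProd
    (h0 : twistedProd α χ ((List.finRange r).map ω) ≠ 0) :
    LinearIndependent (locInvariants G α B A)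
      (fun I : Fin p ↪o Fin r => twistedProd α χ ((List.ofFn I).map ω)) := by
  have := isDomain_loc A hB
  have : Finite (Fin p ↪o Fin r) := Finite.of_injective _ DFunLike.coe_injective
  cases nonempty_fintype (Fin p ↪o Fin r)
  rw [Fintype.linearIndependent_iff]
  intro c hc I
  obtain ⟨ε, h1, -, h3⟩ := sum_smul_mul_compl (p := p) hG hB ρ χ hacc hω I
  have h4 := h3 fun J => (c J : A)
  simp only [← locInvariants_smul] at h4
  rw [hc, zero_mul] at h4
  have h5 := (smul_eq_zero.1 h4.symm).resolve_right h0
  rw [mul_eq_zero, or_iff_left] at h5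
  · exact Subtype.ext h5
  · refine mul_ne_zero ?_ (Qloc_ne_zero A hB χ)
    rintro rfl
    simp at h1

theorem exists_smul_eq_sum [Fintype (Fin p ↪o Fin r)] (hr : Module.finrank k M = r)
    (h0 : twistedProd α χ ((List.finRange r).map ω) ≠ 0) {x : Forms k A M}
    (hx : x ∈ formsDeg k A M p) :
    ∃ D : A, D ≠ 0 ∧ ∃ c : (Fin p ↪o Fin r) → A,
      ∑ J, c J • twistedProd α χ ((List.ofFn J).map ω) = D • x := by
  have := isDomain_loc A hB
  have hQ := Qloc_ne_zero A hB χ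
  have hprod : ((List.finRange r).map ω).prod ≠ 0 := by
    intro h
    refine h0 (forms_smul_eq_zero (pow_ne_zero (List.finRange r).length hQ) ?_)
    rw [Qloc_pow_smul_twistedProd hG hB ρ χ hacc hω, h, smul_zero]
  obtain ⟨d, hd, hspan⟩ := exists_smul_mem_span hr (fun i => (hω i).2) hprod
  -- `d ^ p` clears the denominators of Cramer's rule, and `Q_χ` turns an ordinary product into a
  -- multiple of the twisted one.
  refine ⟨Qloc α A χ * d ^ p, mul_ne_zero hQ (pow_ne_zero _ hd), ?_⟩
  rw [← Submodule.mem_span_range_iff_exists_fun, mul_smul]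
  have h1 := pow_smul_mem_span hspan hx
  generalize d ^ p • x = y at h1
  induction h1 using Submodule.span_induction with
  | zero => rw [smul_zero]; exact zero_mem _
  | add x y _ _ hx hy => rw [smul_add]; exact add_mem hx hy
  | smul c x _ hx => rw [smul_comm]; exact Submodule.smul_mem _ _ hx
  | mem x hx =>
    obtain ⟨l, hl, rfl⟩ := hx
    rw [← Qloc_pow_smul_twistedProd hG hB ρ χ hacc hω]
    refine Submodule.smul_mem _ _ ?_
    by_cases hn : l.Nodup
    · obtain ⟨I, hI⟩ := exists_perm_ofFn hn hl
      have hI' : twistedProd α χ ((List.ofFn I).map ω) ∈ Submodule.span A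
          (Set.range fun J : Fin p ↪o Fin r => twistedProd α χ ((List.ofFn J).map ω)) :=
        Submodule.subset_span ⟨I, rfl⟩
      rcases twistedProd_perm hG hB ρ χ hacc hω hI with h | h
      · rwa [h]
      · rw [h]
        exact neg_mem hI'
    · rw [twistedProd_eq_zero hG hB ρ χ hacc hω hn]
      exact zero_mem _

/-- Up to sign, the coefficient `c I / D` of `x` is also the coordinate of a top degree form of
character `χ`, and `htop` places that coordinate in `(T^G)⁻¹R`. -/
theorem span_twistedProd (hr : Module.finrank k M = r)
    (h0 : twistedProd α χ ((List.finRange r).map ω) ≠ 0)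
    (htop : ∀ y ∈ formsChiDeg A hB ρ χ r, ∃ c : locInvariants G α B A,
      y = c • twistedProd α χ ((List.finRange r).map ω)) :
    Submodule.span (locInvariants G α B A) (Set.range
      fun I : Fin p ↪o Fin r => twistedProd α χ ((List.ofFn I).map ω)) =
        formsChiDeg A hB ρ χ p := by
  have := isDomain_loc A hB
  have hQ := Qloc_ne_zero A hB χ
  have : Finite (Fin p ↪o Fin r) := Finite.of_injective _ DFunLike.coe_injective
  cases nonempty_fintype (Fin p ↪o Fin r)
  apply le_antisymm
  · rw [Submodule.span_le]
    rintro _ ⟨I, rfl⟩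
    have := twistedProd_mem_deg hG hB ρ χ hacc hω (List.ofFn I)
    rwa [List.length_ofFn] at this
  · intro x hx
    obtain ⟨D, hD, c, hc⟩ := exists_smul_eq_sum (p := p) hG hB ρ χ hacc hω hr h0 hx.2
    have key (I : Fin p ↪o Fin r) : ∃ b : locInvariants G α B A, c I = D * b := by
      obtain ⟨ε, hε, hεR, h3⟩ := sum_smul_mul_compl (p := p) hG hB ρ χ hacc hω I
      have hcl := twistedProd_mem_deg hG hB ρ χ hacc hω (complList I)
      have hν := (Qloc_smul_eq_mul_iff hB ρ χ hacc hx.1 hcl.1 _).2 rfl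
      have hνχ := twistedMul_mem hG hB ρ χ hacc hx.1 hcl.1
      -- The twisted product of `x` with the product complementary to `I` has degree `r`.
      obtain ⟨a, ha⟩ := htop (twistedMul α χ x (twistedProd α χ ((complList I).map ω)))
        ⟨hνχ, mem_formsDeg_of_smul_mem hQ (by
          have h := mul_mem_formsDeg hx.2 hcl.2
          rwa [add_length_complList I, ← hν] at h)⟩
      have h4 := h3 c
      rw [hc, smul_mul_assoc, ← hν, ha, locInvariants_smul, smul_smul, smul_smul] at h4
      have h5 := smul_left_injective A h0 h4
      refine ⟨⟨ε, hεR⟩ * a, mul_left_cancel₀ hQ ?_⟩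
      change _ = Qloc α A χ * (D * (ε * a))
      -- `ε² = 1` moves the sign across: `c I = D ε a`.
      linear_combination (-Qloc α A χ * c I) * hε - ε * h5
    choose b hb using key
    have hx' : x = ∑ I, b I • twistedProd α χ ((List.ofFn I).map ω) := by
      refine forms_smul_cancel hD ?_
      rw [← hc, Finset.smul_sum]
      exact Finset.sum_congr rfl fun I _ => by rw [hb, mul_smul, locInvariants_smul (b I)]
    rw [hx']
    exact sum_mem fun I _ => Submodule.smul_mem _ _ (Submodule.subset_span ⟨I, rfl⟩)

-- For `r = 0` the basis condition is vacuous, so the relation must hold by itself: `det_M` is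
-- trivial and `vol` is a scalar.
omit [CharZero k] [FiniteDimensional k V] [FiniteDimensional k M] hG hω hacc in
include hB in
theorem exists_smul_one_eq_vol (hr : Module.finrank k M = 0)
    {vol : ExteriorAlgebra k (Module.Dual k M)} (hvol : vol ∈ ⋀[k]^0 (Module.Dual k M)) :
    ∃ c : locInvariants G α B A, c • (Qloc α A χ ⊗ₜ[k] (1 : ExteriorAlgebra k (Module.Dual k M))) =
      Qloc α A (χ * detRep ρ) ⊗ₜ[k] vol := by
  rw [ExteriorAlgebra.exteriorPower, pow_zero, Submodule.mem_one] at hvol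
  obtain ⟨c, rfl⟩ := hvol
  have hdet : χ * detRep ρ = χ := by
    ext g
    rw [MonoidHom.mul_apply, Units.val_mul]
    exact mul_right_eq_self₀.2 (Or.inl (LinearMap.det_eq_one_of_finrank_eq_zero hr _))
  refine ⟨⟨algebraMap k A c, mem_locInvariants A hB fun g => AlgHom.commutes _ c⟩, ?_⟩
  rw [hdet, locInvariants_smul, algebraMap_smul, Algebra.algebraMap_eq_smul_one,
    TensorProduct.tmul_smul]

/-- The complement of `I` is empty, so its list is a permutation of all the indices, and agreement
up to sign suffices. -/
theorem twistedProd_mem_span_top (I : Fin r ↪o Fin r) :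
    twistedProd α χ ((List.ofFn I).map ω) ∈ Submodule.span (locInvariants G α B A)
      {twistedProd α χ ((List.finRange r).map ω)} := by
  have h := perm_append_complList I
  rw [List.eq_nil_of_length_eq_zero (l := complList I) (by
    have := add_length_complList I
    omega), List.append_nil] at h
  rcases twistedProd_perm hG hB ρ χ hacc hω h with h | h
  · rw [h]
    exact Submodule.mem_span_singleton_self _
  · rw [h]
    exact neg_mem (Submodule.mem_span_singleton_self _)

end Basis

end Twisted

end TwistedExterior

/-! ### The theorem. -/

open TwistedExterior
theorem mainTheorem2 {k : Type*} [Field k] [CharZero k]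
    {V : Type*} [AddCommGroup V] [Module k V] [FiniteDimensional k V]
    (G : Subgroup (V ≃ₗ[k] V)) [Finite G]
    (hG : Subgroup.closure {s : V ≃ₗ[k] V | s ∈ G ∧ IsReflection s} = G)
    {M : Type*} [AddCommGroup M] [Module k M] [FiniteDimensional k M]
    (ρ : Representation k G M) (χ : G →* kˣ)
    (α : Submodule k V → Module.Dual k V) (B : Set (Submodule k V)) (hB : IsBadData G α B)
    (hgood : ∀ H ∈ hyperplanes G \ B, IsGood G H ρ ∧ IsAcceptable G H ρ χ)
    (A : Type*) [CommRing A] [Algebra k A] [Algebra (PolyFun k V) A]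
    [IsScalarTower k (PolyFun k V) A] [IsLocalization (badMonoid α B) A]
    (r : ℕ) (hr : Module.finrank k M = r)
    (vol : ExteriorAlgebra k (Module.Dual k M)) (hvol : vol ∈ ⋀[k]^r (Module.Dual k M))
    (hvol0 : vol ≠ 0) :
    (∀ μ ∈ formsChi A hB ρ χ, ∀ ω ∈ formsChi A hB ρ χ,
      twistedMul α χ μ ω ∈ formsChi A hB ρ χ ∧
        ∀ ν : Forms k A M, Qloc α A χ • ν = μ * ω ↔ ν = twistedMul α χ μ ω) ∧
    ∀ ω : Fin r → Forms k A M, (∀ i, ω i ∈ formsChiDeg A hB ρ χ 1) →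
      ((∀ p : ℕ, 1 ≤ p → p ≤ r →
          LinearIndependent (locInvariants G α B A)
            (fun i : Fin p ↪o Fin r => twistedProd α χ (List.ofFn fun a => ω (i a))) ∧
          Submodule.span (locInvariants G α B A) (Set.range
            (fun i : Fin p ↪o Fin r => twistedProd α χ (List.ofFn fun a => ω (i a)))) =
              formsChiDeg A hB ρ χ p) ↔
        EqUpToUnit (locInvariants G α B A) (twistedProd α χ (List.ofFn ω))
          (Qloc α A (χ * detRep ρ) ⊗ₜ[k] vol)) := by
  have hA := isDomain_loc A hB
  have hacc := fun H hH => (hgood H hH).2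
  refine ⟨fun μ hμ ω hω => ⟨twistedMul_mem hG hB ρ χ hacc hμ hω,
    Qloc_smul_eq_mul_iff hB ρ χ hacc hμ hω⟩, fun ω hω => ?_⟩
  have hvolmem := Qloc_tmul_vol_mem (A := A) hG hB ρ χ hr hvol
  have hQ0 : Qloc α A (χ * detRep ρ) ⊗ₜ[k] vol ≠ 0 := fun h =>
    Qloc_ne_zero A hB (χ * detRep ρ) ((tmul_eq_zero_iff hvol0).1 h)
  have htopmem := twistedProd_mem_deg hG hB ρ χ hacc hω (List.finRange r)
  rw [List.length_finRange] at htopmem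
  have hfam (p : ℕ) : (fun i : Fin p ↪o Fin r => twistedProd α χ (List.ofFn fun a => ω (i a))) =
      fun i : Fin p ↪o Fin r => twistedProd α χ ((List.ofFn i).map ω) := by
    funext i
    rw [List.map_ofFn]
    rfl
  simp only [hfam]
  rw [List.ofFn_eq_map]
  constructor
  · intro h
    obtain ⟨c, hc⟩ : ∃ c : locInvariants G α B A,
        c • twistedProd α χ ((List.finRange r).map ω) =
          Qloc α A (χ * detRep ρ) ⊗ₜ[k] vol := by
      rcases Nat.eq_zero_or_pos r with rfl | h0
      · exact exists_smul_one_eq_vol hB ρ χ hr hvol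
      -- Only the case `p = r` of the basis property is needed.
      · rw [← (h r h0 le_rfl).2] at hvolmem
        rw [← Submodule.mem_span_singleton]
        refine Submodule.span_le.2 ?_ hvolmem
        rintro _ ⟨I, rfl⟩
        exact twistedProd_mem_span_top hG hB ρ χ hacc hω I
    obtain ⟨c', hc'⟩ := exists_smul_vol hG hB ρ χ hr hvol hvol0 htopmem
    -- Each of the two top degree forms is a multiple of the other, and `Ω` is torsion-free, so the
    -- two factors are inverse to each other.
    have hcc : c * c' = 1 := by
      apply Subtype.ext
      refine smul_left_injective A hQ0 ?_
      change ((c : A) * c') • _ = (1 : A) • _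
      rw [mul_smul, ← locInvariants_smul c', ← hc', ← locInvariants_smul, hc, one_smul]
    exact ⟨⟨c, c', hcc, by rw [mul_comm, hcc]⟩, hc⟩
  · rintro ⟨u, hu⟩ p - -
    have h0 : twistedProd α χ ((List.finRange r).map ω) ≠ 0 := by
      intro h
      rw [h, smul_zero] at hu
      exact hQ0 hu.symm
    refine ⟨linearIndependent_twistedProd hG hB ρ χ hacc hω h0,
      span_twistedProd hG hB ρ χ hacc hω hr h0 fun y hy => ?_⟩
    obtain ⟨c, rfl⟩ := exists_smul_vol hG hB ρ χ hr hvol hvol0 hy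
    exact ⟨c * u, by rw [← hu, mul_smul]⟩
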